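/- Let $(\Omega,\mathcal F,\nu)$ be a probability space and let $f(u)=u^3-u$. Let $u:\Omega\times[0,\infty)\to\mathbb R$ be a bounded solution of the nonlocal differential equation $$\partial_t u(x,t) = -f(u(x,t)) + \int_\Omega f(u(y,t))\,d\nu(y),\qquad x\in\Omega,\ t\ge 0,$$ that is, $u(\cdot,t)$ is measurable for every $t\ge 0$, $\sup_{x\in\Omega,\,t\ge0}|u(x,t)|<\infty$, and the equation holds at every $x\in\Omega$ and every $t\ge0$ (with the one-sided time derivative at $t=0$). Suppose that $u(\cdot,t)$ fails to converge in $L^2(\Omega,\nu)$ to a limit as $t\to\infty$. Then $$\int_\Omega u(x,0)\,d\nu(x)=0,$$ and moreover there exists $c\in\mathbb R$ such that the three sets $$\{x\in\Omega : u(x,0)=c\},\qquad \{x\in\Omega : u(x,0)>c\},\qquad \{x\in\Omega : u(x,0)<c\}$$ each have $\nu$-measure exactly $\tfrac13$. -/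

import Mathlib

open MeasureTheory Filter Topology
open scoped ENNReal

/-- `u x t` is a bounded solution on the time interval `[0, ∞)` of the nonlocal equation
`∂ₜ u(x,t) = - f (u(x,t)) + ∫ f (u(y,t)) dν(y)`.
Each `u(·,t)` is a bounded measurable function, with a bound that is uniform in time, and the
equation holds at every point `x` and every time `t ≥ 0` (at `t = 0` the time derivative is
one-sided; values of `u` at negative times play no role). -/
structure IsBoundedSolution {Ω : Type*} [MeasurableSpace Ω] (ν : Measure Ω) (f : ℝ → ℝ)
    (u : Ω → ℝ → ℝ) : Prop where
  measurable : ∀ t : ℝ, 0 ≤ t → Measurable fun x => u x t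
  bounded : ∃ M : ℝ, ∀ x : Ω, ∀ t : ℝ, 0 ≤ t → |u x t| ≤ M
  equation : ∀ x : Ω, ∀ t : ℝ, 0 ≤ t →
    HasDerivWithinAt (fun s => u x s) (-f (u x t) + ∫ y, f (u y t) ∂ν) (Set.Ici 0) t

/-- `u(·,t)` converges in `L²(ν)` to some limit in `L²(ν)` as `t → ∞`. -/
def ConvergesInL2 {Ω : Type*} [MeasurableSpace Ω] (ν : Measure Ω) (u : Ω → ℝ → ℝ) : Prop :=
  ∃ g : Ω → ℝ, MemLp g 2 ν ∧
    Tendsto (fun t : ℝ => eLpNorm (fun x => u x t - g x) 2 ν) atTop (𝓝 0)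

/-! Write `f v = v ^ 3 - v`, let `σ(t)` be the mean of `f(u)` and `m` the mean of `u`. The flow
conserves `m`, and the energy decreases at a rate equal to the variance of `f(u)`. This rate is
Lipschitz in time, so it tends to zero: at late times `f(u)` is nearly the constant `σ(t)`. If `σ`
converged, so would every trajectory, and dominated convergence would give an `L²` limit. Hence `σ`
oscillates and takes every value `s` of some interval at arbitrarily late times. Where `f = s` has a
single root, `u` concentrates there, so the root is `m`; this allows at most one such `s`. So the
interval may be chosen where there are three roots.

The limit of the energy makes the second moment asymptotically affine in `σ`. Integrating Lagrange's
interpolation polynomial then gives the limit mass near a root `r` as `(m r³ + r² + κ) / (3 r² - 1)`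
with a fixed `κ` (`tendsto_measureReal_cell`). Near the lowest root this mass cannot depend on `s`:
while `σ` stays below the local maximum of `f`, trajectories only enter the bottom cell, and `σ`
crosses between any two values both ways (`bottom_limit_eq`). A cubic without linear term would then
have three distinct negative roots, so it vanishes identically: `m = 0`, and every limit mass is
1/3.

To pass from late times to time 0, note that trajectories keep their order. Along fast times `τ n`
the outer cells stabilize almost everywhere to two sets of measure 1/3, while the remaining third
converges to the middle root. The cross ratio of four ordered trajectories cannot decrease, so two
middle trajectories with a common limit must have started at the same point (`not_lt_of_tendsto`).
That point is `c`. -/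

/-! ### Conserved mean, energy dissipation and asymptotic moments -/

section Basic

variable {Ω : Type*} [MeasurableSpace Ω] {ν : Measure Ω} {u : Ω → ℝ → ℝ}

/-- The spatial mean of the nonlinearity `v ^ 3 - v` along `u(·, t)`. -/
noncomputable def meanForce (ν : Measure Ω) (u : Ω → ℝ → ℝ) (t : ℝ) : ℝ :=
  ∫ y, ((u y t) ^ 3 - u y t) ∂ν

namespace IsBoundedSolution

theorem hasDerivWithinAt (hu : IsBoundedSolution ν (fun v : ℝ => v ^ 3 - v) u) (x : Ω) {t : ℝ}
    (ht : 0 ≤ t) :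
    HasDerivWithinAt (u x) (meanForce ν u t - ((u x t) ^ 3 - u x t)) (Set.Ici 0) t := by
  have h := hu.equation x t ht
  have e : meanForce ν u t - ((u x t) ^ 3 - u x t) =
      -(fun v : ℝ => v ^ 3 - v) (u x t) + ∫ y, (fun v : ℝ => v ^ 3 - v) (u y t) ∂ν := by
    simp only [meanForce]; ring
  rw [e]; exact h

theorem hasDerivAt (hu : IsBoundedSolution ν (fun v : ℝ => v ^ 3 - v) u) (x : Ω) {t : ℝ}
    (ht : 0 < t) :
    HasDerivAt (u x) (meanForce ν u t - ((u x t) ^ 3 - u x t)) t :=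
  (hu.hasDerivWithinAt x ht.le).hasDerivAt (Ici_mem_nhds ht)

theorem continuousOn (hu : IsBoundedSolution ν (fun v : ℝ => v ^ 3 - v) u) (x : Ω) :
    ContinuousOn (u x) (Set.Ici 0) := fun _ ht =>
  (hu.hasDerivWithinAt x ht).continuousWithinAt

theorem exists_bound (hu : IsBoundedSolution ν (fun v : ℝ => v ^ 3 - v) u) :
    ∃ M : ℝ, 1 ≤ M ∧ ∀ x : Ω, ∀ t : ℝ, 0 ≤ t → |u x t| ≤ M := by
  obtain ⟨M, hM⟩ := hu.bounded
  exact ⟨max M 1, le_max_right _ _, fun x t ht => (hM x t ht).trans (le_max_left _ _)⟩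

theorem exists_bound_comp (hu : IsBoundedSolution ν (fun v : ℝ => v ^ 3 - v) u) {φ : ℝ → ℝ}
    (hφ : Continuous φ) : ∃ C : ℝ, 0 ≤ C ∧ ∀ x : Ω, ∀ t : ℝ, 0 ≤ t → |φ (u x t)| ≤ C := by
  obtain ⟨M, -, hM⟩ := hu.exists_bound
  obtain ⟨C, hC⟩ := (isCompact_Icc (a := -M) (b := M)).exists_bound_of_continuousOn
    hφ.continuousOn
  exact ⟨max C 0, le_max_right _ _, fun x t ht =>
    (hC _ (abs_le.mp (hM x t ht))).trans (le_max_left _ _)⟩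

theorem measurable_comp (hu : IsBoundedSolution ν (fun v : ℝ => v ^ 3 - v) u) {φ : ℝ → ℝ}
    (hφ : Continuous φ) {t : ℝ} (ht : 0 ≤ t) : Measurable fun x => φ (u x t) :=
  hφ.measurable.comp (hu.measurable t ht)

variable [IsProbabilityMeasure ν]

theorem integrable_comp (hu : IsBoundedSolution ν (fun v : ℝ => v ^ 3 - v) u) {φ : ℝ → ℝ}
    (hφ : Continuous φ) {t : ℝ} (ht : 0 ≤ t) : Integrable (fun x => φ (u x t)) ν := by
  obtain ⟨C, -, hC⟩ := hu.exists_bound_comp hφ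
  exact Integrable.of_bound (hu.measurable_comp hφ ht).aestronglyMeasurable C
    (ae_of_all _ fun x => hC x t ht)

theorem exists_bound_integral (hu : IsBoundedSolution ν (fun v : ℝ => v ^ 3 - v) u) {φ : ℝ → ℝ}
    (hφ : Continuous φ) : ∃ C : ℝ, 0 ≤ C ∧ ∀ t : ℝ, 0 ≤ t → |∫ x, φ (u x t) ∂ν| ≤ C := by
  obtain ⟨C, hC0, hC⟩ := hu.exists_bound_comp hφ
  refine ⟨C, hC0, fun t ht => ?_⟩
  have := norm_integral_le_of_norm_le_const (μ := ν) (C := C)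
    (f := fun x => φ (u x t)) (ae_of_all _ fun x => hC x t ht)
  simpa using this

theorem continuousOn_integral_comp (hu : IsBoundedSolution ν (fun v : ℝ => v ^ 3 - v) u)
    {φ : ℝ → ℝ} (hφ : Continuous φ) :
    ContinuousOn (fun t => ∫ x, φ (u x t) ∂ν) (Set.Ici 0) := by
  obtain ⟨C, -, hC⟩ := hu.exists_bound_comp hφ
  intro t ht
  refine continuousWithinAt_of_dominated (bound := fun _ => C) ?_ ?_ (integrable_const C) ?_
  · filter_upwards [self_mem_nhdsWithin] with s hs
    exact (hu.measurable_comp hφ hs).aestronglyMeasurable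
  · filter_upwards [self_mem_nhdsWithin] with s hs
    exact ae_of_all _ fun x => hC x s hs
  · exact ae_of_all _ fun x => hφ.continuousAt.comp_continuousWithinAt (hu.continuousOn x t ht)

theorem continuous_cubic : Continuous fun v : ℝ => v ^ 3 - v := by fun_prop

theorem continuousOn_meanForce (hu : IsBoundedSolution ν (fun v : ℝ => v ^ 3 - v) u) :
    ContinuousOn (meanForce ν u) (Set.Ici 0) :=
  hu.continuousOn_integral_comp continuous_cubic

theorem hasDerivAt_integral_comp (hu : IsBoundedSolution ν (fun v : ℝ => v ^ 3 - v) u)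
    {φ φ' : ℝ → ℝ} (hφ : ∀ v, HasDerivAt φ (φ' v) v) (hφ' : Continuous φ') {t : ℝ} (ht : 0 < t) :
    HasDerivAt (fun t => ∫ x, φ (u x t) ∂ν)
      (∫ x, φ' (u x t) * (meanForce ν u t - ((u x t) ^ 3 - u x t)) ∂ν) t := by
  have hφc : Continuous φ := continuous_iff_continuousAt.mpr fun v => (hφ v).continuousAt
  obtain ⟨C, hC0, hC⟩ := hu.exists_bound_comp hφ'
  obtain ⟨A, hA0, hA⟩ := hu.exists_bound_comp continuous_cubic
  obtain ⟨B, hB0, hB⟩ := hu.exists_bound_integral continuous_cubic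
  refine (hasDerivAt_integral_of_dominated_loc_of_deriv_le (μ := ν) (s := Set.Ioi 0)
    (bound := fun _ => C * (B + A)) (F := fun t x => φ (u x t))
    (F' := fun t x => φ' (u x t) * (meanForce ν u t - ((u x t) ^ 3 - u x t)))
    (Ioi_mem_nhds ht) ?_ (hu.integrable_comp hφc ht.le) ?_ ?_ (integrable_const _) ?_).2
  · filter_upwards [Ioi_mem_nhds ht] with s hs
    exact (hu.measurable_comp hφc (le_of_lt hs)).aestronglyMeasurable
  · exact ((hu.measurable_comp hφ' ht.le).mul
      (measurable_const.sub (hu.measurable_comp continuous_cubic ht.le))).aestronglyMeasurable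
  · refine ae_of_all _ fun x s hs => ?_
    have hs : 0 ≤ s := le_of_lt hs
    rw [Real.norm_eq_abs, abs_mul]
    exact mul_le_mul (hC x s hs) ((abs_sub _ _).trans (add_le_add (hB s hs) (hA x s hs)))
      (abs_nonneg _) hC0
  · refine ae_of_all _ fun x s hs => ?_
    exact (hφ (u x s)).comp s (hu.hasDerivAt x hs)

theorem exists_bound_deriv (hu : IsBoundedSolution ν (fun v : ℝ => v ^ 3 - v) u)
    {φ : ℝ → ℝ} (hφ : Continuous φ) : ∃ C : ℝ, 0 ≤ C ∧ ∀ t : ℝ, 0 ≤ t →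
      |∫ x, φ (u x t) * (meanForce ν u t - ((u x t) ^ 3 - u x t)) ∂ν| ≤ C := by
  obtain ⟨C, hC0, hC⟩ := hu.exists_bound_comp hφ
  obtain ⟨A, hA0, hA⟩ := hu.exists_bound_comp continuous_cubic
  obtain ⟨B, hB0, hB⟩ := hu.exists_bound_integral continuous_cubic
  refine ⟨C * (B + A), by positivity, fun t ht => ?_⟩
  have := norm_integral_le_of_norm_le_const (μ := ν) (C := C * (B + A))
    (f := fun x => φ (u x t) * (meanForce ν u t - ((u x t) ^ 3 - u x t)))
    (ae_of_all _ fun x => by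
      rw [Real.norm_eq_abs, abs_mul]
      exact mul_le_mul (hC x t ht) ((abs_sub _ _).trans (add_le_add (hB t ht) (hA x t ht)))
        (abs_nonneg _) hC0)
  simpa using this

/-- The nonlocal term is exactly the mean of the local one, so the right-hand side has mean zero. -/
theorem integral_eq (hu : IsBoundedSolution ν (fun v : ℝ => v ^ 3 - v) u) {t : ℝ} (ht : 0 ≤ t) :
    ∫ x, u x t ∂ν = ∫ x, u x 0 ∂ν := by
  have hc := hu.continuousOn_integral_comp continuous_id
  have hd : ∀ s, 0 < s → HasDerivAt (fun t => ∫ x, id (u x t) ∂ν) 0 s := fun s hs => by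
    have h := hu.hasDerivAt_integral_comp (φ := id) (φ' := fun _ => 1) (fun v => hasDerivAt_id v)
      continuous_const hs
    convert h using 1
    simp only [one_mul]
    rw [integral_sub (integrable_const _) (hu.integrable_comp continuous_cubic hs.le)]
    simp [meanForce]
  rcases ht.eq_or_lt with rfl | ht'
  · rfl
  obtain ⟨c, hc1, hc2⟩ := exists_hasDerivAt_eq_slope (fun t => ∫ x, id (u x t) ∂ν) (fun _ => 0) ht'
    (hc.mono Set.Icc_subset_Ici_self) (fun s hs => hd s hs.1)
  have h0 := hc2.symm
  rw [div_eq_zero_iff] at h0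
  rcases h0 with h0 | h0
  · exact sub_eq_zero.mp h0
  · linarith

/-- The spatial variance of `v ^ 3 - v` along `u(·, t)`. -/
noncomputable def _root_.forceVariance (ν : Measure Ω) (u : Ω → ℝ → ℝ) (t : ℝ) : ℝ :=
  ∫ x, ((u x t) ^ 3 - u x t) ^ 2 ∂ν - meanForce ν u t ^ 2

theorem integral_sq_sub_meanForce (hu : IsBoundedSolution ν (fun v : ℝ => v ^ 3 - v) u) {t : ℝ}
    (ht : 0 ≤ t) :
    ∫ x, ((u x t) ^ 3 - u x t - meanForce ν u t) ^ 2 ∂ν = forceVariance ν u t := by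
  have h1 := hu.integrable_comp (φ := fun v => (v ^ 3 - v) ^ 2) (by fun_prop) ht
  have h2 := hu.integrable_comp continuous_cubic ht
  have e : ∀ x, ((u x t) ^ 3 - u x t - meanForce ν u t) ^ 2 =
    ((u x t) ^ 3 - u x t) ^ 2 - (2 * meanForce ν u t) * ((u x t) ^ 3 - u x t)
      + meanForce ν u t ^ 2 := fun x => by ring
  simp_rw [e]
  rw [integral_add (f := fun x => ((u x t) ^ 3 - u x t) ^ 2 - 2 * meanForce ν u t *
      ((u x t) ^ 3 - u x t)) (h1.sub (h2.const_mul _)) (integrable_const _),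
    integral_sub h1 (h2.const_mul _), integral_const_mul]
  change _ - _ * meanForce ν u t + _ = _
  simp only [integral_const, probReal_univ, one_smul, forceVariance]
  ring

theorem forceVariance_nonneg (hu : IsBoundedSolution ν (fun v : ℝ => v ^ 3 - v) u) {t : ℝ}
    (ht : 0 ≤ t) : 0 ≤ forceVariance ν u t := by
  rw [← hu.integral_sq_sub_meanForce ht]
  exact integral_nonneg fun x => sq_nonneg _

/-- The energy of `u(·, t)`. -/
noncomputable def _root_.energy (ν : Measure Ω) (u : Ω → ℝ → ℝ) (t : ℝ) : ℝ :=
  ∫ x, ((u x t) ^ 4 / 4 - (u x t) ^ 2 / 2) ∂ν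

theorem hasDerivAt_energy (hu : IsBoundedSolution ν (fun v : ℝ => v ^ 3 - v) u) {t : ℝ}
    (ht : 0 < t) : HasDerivAt (energy ν u) (-forceVariance ν u t) t := by
  have h := hu.hasDerivAt_integral_comp (φ := fun v => v ^ 4 / 4 - v ^ 2 / 2)
    (φ' := fun v => v ^ 3 - v) (fun v => by
      have := ((hasDerivAt_pow 4 v).div_const 4).sub ((hasDerivAt_pow 2 v).div_const 2)
      exact this.congr_deriv (by norm_num)) continuous_cubic ht
  refine h.congr_deriv ?_
  have h1 := hu.integrable_comp (φ := fun v => (v ^ 3 - v) ^ 2) (by fun_prop) ht.le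
  have h2 := hu.integrable_comp continuous_cubic ht.le
  have e : ∀ x, ((u x t) ^ 3 - u x t) * (meanForce ν u t - ((u x t) ^ 3 - u x t)) =
    meanForce ν u t * ((u x t) ^ 3 - u x t) - ((u x t) ^ 3 - u x t) ^ 2 := fun x => by ring
  simp only [e]
  rw [integral_sub (h2.const_mul _) h1, integral_const_mul]
  change _ * meanForce ν u t - _ = _
  simp only [forceVariance]
  ring

/-- The time derivative is an integral of polynomials in the bounded function `u`. This regularity
turns finite total dissipation into decay. -/
theorem exists_lipschitz_forceVariance (hu : IsBoundedSolution ν (fun v : ℝ => v ^ 3 - v) u) :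
    ∃ L : ℝ, 0 < L ∧ ∀ t, 0 < t → ∀ t', t ≤ t' →
      |forceVariance ν u t' - forceVariance ν u t| ≤ L * (t' - t) := by
  obtain ⟨B, hB0, hB⟩ := hu.exists_bound_integral continuous_cubic
  have c1 : Continuous fun v : ℝ => 2 * (v ^ 3 - v) * (3 * v ^ 2 - 1) := by fun_prop
  have c2 : Continuous fun v : ℝ => (3 * v ^ 2 - 1) := by fun_prop
  obtain ⟨C1, h10, h1⟩ := hu.exists_bound_deriv c1
  obtain ⟨C2, h20, h2⟩ := hu.exists_bound_deriv c2
  have hf : ∀ v : ℝ, HasDerivAt (fun v : ℝ => v ^ 3 - v) (3 * v ^ 2 - 1) v := fun v => by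
    have := (hasDerivAt_pow 3 v).sub (hasDerivAt_id v)
    exact this.congr_deriv (by simp)
  refine ⟨C1 + 2 * B * C2 + 1, by positivity, fun t ht t' htt' => ?_⟩
  have hd : ∀ s ∈ Set.Icc t t', HasDerivWithinAt (forceVariance ν u)
      ((∫ x, (2 * ((u x s) ^ 3 - u x s) * (3 * (u x s) ^ 2 - 1)) *
          (meanForce ν u s - ((u x s) ^ 3 - u x s)) ∂ν) - 2 * meanForce ν u s *
        ∫ x, (3 * (u x s) ^ 2 - 1) * (meanForce ν u s - ((u x s) ^ 3 - u x s)) ∂ν)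
      (Set.Icc t t') s := fun s hs => by
    have hs0 : 0 < s := ht.trans_le hs.1
    have a1 := hu.hasDerivAt_integral_comp (φ := fun v => (v ^ 3 - v) ^ 2) (fun v => by
      exact ((hf v).pow 2).congr_deriv (by simp)) c1 hs0
    have a2 : HasDerivAt (meanForce ν u) _ s := hu.hasDerivAt_integral_comp hf c2 hs0
    have := a1.sub (a2.pow 2)
    refine HasDerivAt.hasDerivWithinAt ?_
    exact this.congr_deriv (by simp)
  have := (convex_Icc t t').norm_image_sub_le_of_norm_hasDerivWithin_le
    (C := C1 + 2 * B * C2 + 1) hd (fun s hs => ?_) (Set.left_mem_Icc.mpr htt')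
    (Set.right_mem_Icc.mpr htt')
  · simpa [abs_of_nonneg (sub_nonneg.mpr htt')] using this
  · have hs0 : 0 ≤ s := ht.le.trans hs.1
    refine (abs_sub _ _).trans ?_
    rw [abs_mul, abs_mul, abs_two]
    have : 2 * |meanForce ν u s| * |∫ x, (3 * (u x s) ^ 2 - 1) *
        (meanForce ν u s - ((u x s) ^ 3 - u x s)) ∂ν| ≤ 2 * B * C2 :=
      mul_le_mul (by linarith [show |meanForce ν u s| ≤ B from hB s hs0]) (h2 s hs0)
        (abs_nonneg _) (by positivity)
    linarith [h1 s hs0]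

theorem energy_sub_le (hu : IsBoundedSolution ν (fun v : ℝ => v ^ 3 - v) u) {t t' ε : ℝ}
    (ht : 0 < t) (htt' : t ≤ t') (hε : ∀ s ∈ Set.Icc t t', ε ≤ forceVariance ν u s) :
    energy ν u t' - energy ν u t ≤ -ε * (t' - t) := by
  refine (convex_Icc t t').image_sub_le_mul_sub_of_deriv_le
    (fun s hs => (hu.hasDerivAt_energy (ht.trans_le hs.1)).continuousAt.continuousWithinAt)
    (fun s hs => ?_) (fun s hs => ?_) t (Set.left_mem_Icc.mpr htt') t'
    (Set.right_mem_Icc.mpr htt') htt' <;> rw [interior_Icc] at hs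
  · exact (hu.hasDerivAt_energy (ht.trans hs.1)).differentiableAt.differentiableWithinAt
  · rw [(hu.hasDerivAt_energy (ht.trans hs.1)).deriv]
    linarith [hε s (Set.Ioo_subset_Icc_self hs)]

theorem exists_tendsto_energy (hu : IsBoundedSolution ν (fun v : ℝ => v ^ 3 - v) u) :
    ∃ E : ℝ, Tendsto (energy ν u) atTop (𝓝 E) := by
  obtain ⟨B, -, hB⟩ := hu.exists_bound_integral (φ := fun v => v ^ 4 / 4 - v ^ 2 / 2)
    (by fun_prop)
  have hanti : Antitone fun t => energy ν u (max t 1) := fun a b hab => by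
    have h0 : (0 : ℝ) < max a 1 := lt_of_lt_of_le one_pos (le_max_right _ _)
    have := hu.energy_sub_le (ε := 0) h0 (max_le_max_right 1 hab)
      fun s hs => hu.forceVariance_nonneg (h0.le.trans hs.1)
    simp only at this ⊢
    linarith
  have := tendsto_atTop_ciInf hanti ⟨-B, by
    rintro _ ⟨t, rfl⟩
    exact (abs_le.mp (hB (max t 1) (le_trans zero_le_one (le_max_right _ _)))).1⟩
  refine ⟨_, this.congr' ?_⟩
  filter_upwards [eventually_ge_atTop 1] with t ht
  rw [max_eq_left ht]

/-- Barbalat's argument: a variance above `ε` at time `t` stays above `ε / 2` for a time `ε / (2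
L)`, which costs energy `ε² / (4 L)`. At late times the energy varies by less than that. -/
theorem tendsto_forceVariance (hu : IsBoundedSolution ν (fun v : ℝ => v ^ 3 - v) u) :
    Tendsto (forceVariance ν u) atTop (𝓝 0) := by
  obtain ⟨L, hL, hLip⟩ := hu.exists_lipschitz_forceVariance
  obtain ⟨E, hE⟩ := hu.exists_tendsto_energy
  rw [Metric.tendsto_atTop]
  intro ε hε
  obtain ⟨T, hT⟩ := Metric.tendsto_atTop.mp hE (ε ^ 2 / (8 * L)) (by positivity)
  refine ⟨max T 1, fun t ht => ?_⟩
  have ht0 : 0 < t := lt_of_lt_of_le one_pos ((le_max_right _ _).trans ht)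
  rw [Real.dist_eq, sub_zero, abs_of_nonneg (hu.forceVariance_nonneg ht0.le)]
  by_contra! hlt
  have hh : 0 < ε / (2 * L) := by positivity
  have h1 := hu.energy_sub_le (ε := ε / 2) ht0 (le_add_of_nonneg_right hh.le) fun s hs => by
    have h := (abs_le.mp (hLip t ht0 s hs.1)).1
    have : L * (s - t) ≤ L * (ε / (2 * L)) := by gcongr; linarith [hs.2]
    rw [show L * (ε / (2 * L)) = ε / 2 by field_simp] at this
    linarith
  have h2 := hT t ((le_max_left _ _).trans ht)
  have h3 := hT (t + ε / (2 * L)) (by linarith [(le_max_left T 1).trans ht])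
  rw [Real.dist_eq, abs_lt] at h2 h3
  have e : -(ε / 2) * (t + ε / (2 * L) - t) = -(2 * (ε ^ 2 / (8 * L))) := by
    field_simp; ring
  rw [e] at h1
  linarith [h2.2, h3.1]

/-- The `L¹` distance of `v ^ 3 - v` along `u(·, t)` to its mean tends to zero. -/
theorem tendsto_integral_abs_sub (hu : IsBoundedSolution ν (fun v : ℝ => v ^ 3 - v) u) :
    Tendsto (fun t => ∫ x, |(u x t) ^ 3 - u x t - meanForce ν u t| ∂ν) atTop (𝓝 0) := by
  have h := hu.tendsto_forceVariance.sqrt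
  rw [Real.sqrt_zero] at h
  refine squeeze_zero' (Eventually.of_forall fun t => integral_nonneg fun x => abs_nonneg _) ?_ h
  filter_upwards [eventually_ge_atTop 0] with t ht
  refine Real.le_sqrt_of_sq_le ?_
  rw [← hu.integral_sq_sub_meanForce ht]
  set s := meanForce ν u t
  set D := ∫ x, |(u x t) ^ 3 - u x t - s| ∂ν with hD
  have h1 := hu.integrable_comp (φ := fun v => (v ^ 3 - v - s) ^ 2) (by fun_prop) ht
  have h2 := hu.integrable_comp (φ := fun v => |v ^ 3 - v - s|) (by fun_prop) ht
  -- The variance of `|f(u) - s|` is nonnegative, which is Cauchy–Schwarz on a probability space.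
  have h0 : 0 ≤ ∫ x, (|(u x t) ^ 3 - u x t - s| - D) ^ 2 ∂ν :=
    integral_nonneg fun x => sq_nonneg _
  have e : ∀ x, (|(u x t) ^ 3 - u x t - s| - D) ^ 2 = ((u x t) ^ 3 - u x t - s) ^ 2
      - (2 * D) * |(u x t) ^ 3 - u x t - s| + D ^ 2 := fun x => by
    rw [← sq_abs ((u x t) ^ 3 - u x t - s)]; ring
  simp_rw [e] at h0
  rw [integral_add (f := fun x => ((u x t) ^ 3 - u x t - s) ^ 2 - 2 * D *
      |(u x t) ^ 3 - u x t - s|) (h1.sub (h2.const_mul _)) (integrable_const _),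
    integral_sub h1 (h2.const_mul _), integral_const_mul, ← hD] at h0
  simp only [integral_const, probReal_univ, one_smul] at h0
  linarith

/-- A function dominated by `|v ^ 3 - v - s|` has small mean at the times when the mean force
is `s`. -/
theorem tendsto_integral_of_abs_le (hu : IsBoundedSolution ν (fun v : ℝ => v ^ 3 - v) u)
    {l : Filter ℝ} (hl : l ≤ atTop) {g : Ω → ℝ → ℝ} {C : ℝ}
    (hg : ∀ᶠ t in l, ∀ x, |g x t| ≤ C * |(u x t) ^ 3 - u x t - meanForce ν u t|) :
    Tendsto (fun t => ∫ x, g x t ∂ν) l (𝓝 0) := by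
  have h := (hu.tendsto_integral_abs_sub.mono_left hl).const_mul C
  rw [mul_zero] at h
  refine squeeze_zero_norm' ?_ h
  filter_upwards [hg, hl (eventually_ge_atTop 0)] with t h1 ht
  rw [← integral_const_mul]
  exact norm_integral_le_of_norm_le ((hu.integrable_comp
    (φ := fun v => |v ^ 3 - v - meanForce ν u t|) (by fun_prop) ht).const_mul C)
    (ae_of_all _ h1)

/-- The second moment is asymptotically an affine function of the mean force. -/
theorem exists_tendsto_second_moment (hu : IsBoundedSolution ν (fun v : ℝ => v ^ 3 - v) u) :
    ∃ e : ℝ, Tendsto (fun t => ∫ x, (u x t) ^ 2 ∂ν - meanForce ν u t * ∫ x, u x 0 ∂ν)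
      atTop (𝓝 e) := by
  obtain ⟨E, hE⟩ := hu.exists_tendsto_energy
  obtain ⟨M, hM1, hM⟩ := hu.exists_bound
  -- Testing `f(u) ≈ σ` against `u` relates the fourth and second moments; subtracting four times
  -- the energy eliminates the fourth.
  have h1 := hu.tendsto_integral_of_abs_le le_rfl (C := M)
    (g := fun x t => u x t * ((u x t) ^ 3 - u x t - meanForce ν u t)) (by
      filter_upwards [eventually_ge_atTop 0] with t ht x
      rw [abs_mul]
      exact mul_le_mul_of_nonneg_right (hM x t ht) (abs_nonneg _))
  refine ⟨0 - 4 * E, (h1.sub (hE.const_mul 4)).congr' ?_⟩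
  filter_upwards [eventually_ge_atTop 0] with t ht
  have i1 := hu.integrable_comp (φ := fun v => v) continuous_id ht
  have i2 := hu.integrable_comp (φ := fun v => v ^ 2) (by fun_prop) ht
  have i4 := hu.integrable_comp (φ := fun v => v ^ 4) (by fun_prop) ht
  have e1 : ∀ x, u x t * ((u x t) ^ 3 - u x t - meanForce ν u t) =
    (u x t) ^ 4 - (u x t) ^ 2 - meanForce ν u t * u x t := fun x => by ring
  simp_rw [e1, energy]
  rw [integral_sub (f := fun x => (u x t) ^ 4 - (u x t) ^ 2) (i4.sub i2) (i1.const_mul _), integral_sub i4 i2, integral_const_mul,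
    integral_sub (i4.div_const 4) (i2.div_const 2), integral_div, integral_div, hu.integral_eq ht]
  ring

end IsBoundedSolution

end Basic

/-! ### Order preservation, cross ratio and barriers -/

section Order

/-- A solution of a scalar linear homogeneous equation `d' = r d` is a positive multiple of its
initial value. -/
theorem exists_eq_mul_exp_of_hasDerivWithinAt {d r : ℝ → ℝ} (hr : ContinuousOn r (Set.Ici 0))
    (hd : ∀ t, 0 ≤ t → HasDerivWithinAt d (r t * d t) (Set.Ici 0) t) :
    ∃ I : ℝ → ℝ, ∀ t, 0 ≤ t → d t = d 0 * Real.exp (I t) := by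
  have hrc : Continuous fun s => r (max s 0) :=
    hr.comp_continuous (by fun_prop) fun s => le_max_right s 0
  refine ⟨fun t => ∫ s in (0 : ℝ)..t, r (max s 0), fun t ht => ?_⟩
  have hI : ∀ t, HasDerivAt (fun t => ∫ s in (0 : ℝ)..t, r (max s 0)) (r (max t 0)) t := fun t =>
    hrc.integral_hasStrictDerivAt 0 t |>.hasDerivAt
  set I : ℝ → ℝ := fun t => ∫ s in (0 : ℝ)..t, r (max s 0) with hIdef
  have hp : ∀ s, 0 ≤ s →
      HasDerivWithinAt (fun s => d s * Real.exp (-I s)) 0 (Set.Ici 0) s := fun s hs => by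
    have := (hd s hs).mul ((hI s).neg.exp.hasDerivWithinAt (s := Set.Ici 0))
    refine this.congr_deriv ?_
    rw [max_eq_left hs]
    ring
  have hconst := (convex_Ici (0 : ℝ)).is_const_of_fderivWithin_eq_zero (𝕜 := ℝ)
    (f := fun s => d s * Real.exp (-I s)) (fun s hs => (hp s hs).differentiableWithinAt)
    (fun s hs => by
      have h := (hp s hs).hasFDerivWithinAt.fderivWithin (uniqueDiffOn_Ici (0 : ℝ) s hs)
      rw [h]; ext; simp) (Set.mem_Ici.mpr ht) (Set.mem_Ici.mpr le_rfl)
  have h0 : I 0 = 0 := by simp [hIdef]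
  simp only [h0, neg_zero, Real.exp_zero, mul_one] at hconst
  rw [← hconst, mul_assoc, ← Real.exp_add]
  simp

namespace IsBoundedSolution

variable {Ω : Type*} [MeasurableSpace Ω] {ν : Measure Ω} {u : Ω → ℝ → ℝ}

/-- The nonlocal term cancels in a difference, and a difference of cubics contains the factor `u y t
- u x t`. -/
theorem hasDerivWithinAt_sub (hu : IsBoundedSolution ν (fun v : ℝ => v ^ 3 - v) u) (x y : Ω)
    {t : ℝ} (ht : 0 ≤ t) : HasDerivWithinAt (fun t => u y t - u x t)
      ((1 - ((u x t) ^ 2 + u x t * u y t + (u y t) ^ 2)) * (u y t - u x t)) (Set.Ici 0) t :=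
  ((hu.hasDerivWithinAt y ht).sub (hu.hasDerivWithinAt x ht)).congr_deriv (by ring)

theorem exists_sub_eq_mul_exp (hu : IsBoundedSolution ν (fun v : ℝ => v ^ 3 - v) u) (x y : Ω) :
    ∃ I : ℝ → ℝ, ∀ t, 0 ≤ t → u y t - u x t = (u y 0 - u x 0) * Real.exp (I t) := by
  have hx := hu.continuousOn x
  have hy := hu.continuousOn y
  exact exists_eq_mul_exp_of_hasDerivWithinAt (d := fun t => u y t - u x t)
    (r := fun t => 1 - ((u x t) ^ 2 + u x t * u y t + (u y t) ^ 2)) (by fun_prop)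
    fun t ht => hu.hasDerivWithinAt_sub x y ht

theorem lt_iff (hu : IsBoundedSolution ν (fun v : ℝ => v ^ 3 - v) u) (x y : Ω) {t : ℝ}
    (ht : 0 ≤ t) : u x t < u y t ↔ u x 0 < u y 0 := by
  obtain ⟨I, hI⟩ := hu.exists_sub_eq_mul_exp x y
  rw [← sub_pos, hI t ht, mul_pos_iff_of_pos_right (Real.exp_pos _), sub_pos]

/-- The cross ratio of four ordered trajectories is nondecreasing in time. -/
theorem crossRatio_le (hu : IsBoundedSolution ν (fun v : ℝ => v ^ 3 - v) u) {x v v' z : Ω}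
    (h1 : u x 0 < u v 0) (h2 : u v 0 < u v' 0) (h3 : u v' 0 < u z 0) {t : ℝ} (ht : 0 ≤ t) :
    (u v' 0 - u v 0) * (u z 0 - u x 0) / ((u v 0 - u x 0) * (u z 0 - u v' 0)) ≤
      (u v' t - u v t) * (u z t - u x t) / ((u v t - u x t) * (u z t - u v' t)) := by
  set K : ℝ → ℝ := fun t =>
    (u v' t - u v t) * (u z t - u x t) / ((u v t - u x t) * (u z t - u v' t)) with hK
  -- Adding the four growth rates, the squares cancel and the logarithmic derivative factors as `(v'
  -- - x) * (z - v)`, positive by the order.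
  have hd : ∀ s, 0 ≤ s → HasDerivWithinAt K
      ((u v' s - u v s) * (u z s - u x s) / ((u v s - u x s) * (u z s - u v' s)) *
        ((u v' s - u x s) * (u z s - u v s))) (Set.Ici 0) s := fun s hs => by
    have l1 : u v s - u x s ≠ 0 := (sub_pos.mpr ((hu.lt_iff x v hs).mpr h1)).ne'
    have l3 : u z s - u v' s ≠ 0 := (sub_pos.mpr ((hu.lt_iff v' z hs).mpr h3)).ne'
    have := ((hu.hasDerivWithinAt_sub v v' hs).mul (hu.hasDerivWithinAt_sub x z hs)).div
      ((hu.hasDerivWithinAt_sub x v hs).mul (hu.hasDerivWithinAt_sub v' z hs))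
      (mul_ne_zero l1 l3)
    refine this.congr_deriv ?_
    simp only [Pi.mul_apply]
    field_simp
    ring
  have hm : MonotoneOn K (Set.Ici 0) := by
    refine monotoneOn_of_deriv_nonneg (convex_Ici 0) (fun s hs => (hd s hs).continuousWithinAt)
      (fun s hs => ?_) fun s hs => ?_ <;> rw [interior_Ici] at hs
    · exact ((hd s (le_of_lt hs)).hasDerivAt (Ici_mem_nhds hs)).differentiableAt
        |>.differentiableWithinAt
    · rw [((hd s (le_of_lt hs)).hasDerivAt (Ici_mem_nhds hs)).deriv]
      have l1 := (hu.lt_iff x v (le_of_lt hs)).mpr h1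
      have l2 := (hu.lt_iff v v' (le_of_lt hs)).mpr h2
      have l3 := (hu.lt_iff v' z (le_of_lt hs)).mpr h3
      have p1 := sub_pos.mpr l1
      have p2 := sub_pos.mpr l2
      have p3 := sub_pos.mpr l3
      have p4 := sub_pos.mpr (l1.trans l2)
      have p5 := sub_pos.mpr (l2.trans l3)
      have p6 := sub_pos.mpr (l1.trans (l2.trans l3))
      positivity
  exact hm (Set.mem_Ici.mpr le_rfl) (Set.mem_Ici.mpr ht) ht

/-- A level at which the velocity is negative can only be crossed downwards. -/
theorem le_of_meanForce_lt (hu : IsBoundedSolution ν (fun v : ℝ => v ^ 3 - v) u) (x : Ω)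
    {p t t' : ℝ} (ht : 0 ≤ t) (htt' : t ≤ t') (hp : ∀ s ∈ Set.Icc t t', meanForce ν u s < p ^ 3 - p)
    (h : u x t ≤ p) : u x t' ≤ p := by
  refine image_le_of_deriv_right_lt_deriv_boundary' (f := u x) (a := t) (b := t')
    (B := fun _ => p) (B' := fun _ => 0)
    ((hu.continuousOn x).mono fun s hs => ht.trans hs.1)
    (fun s hs => (hu.hasDerivWithinAt x (ht.trans hs.1)).mono
      (Set.Ici_subset_Ici.mpr (ht.trans hs.1))) h continuousOn_const
    (fun s _ => hasDerivWithinAt_const _ _ _) (fun s hs hsp => ?_) (Set.right_mem_Icc.mpr htt')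
  have := hp s (Set.Ico_subset_Icc_self hs)
  simp only [hsp]
  linarith

/-- A level at which the velocity is positive can only be crossed upwards. -/
theorem le_of_lt_meanForce (hu : IsBoundedSolution ν (fun v : ℝ => v ^ 3 - v) u) (x : Ω)
    {p t t' : ℝ} (ht : 0 ≤ t) (htt' : t ≤ t') (hp : ∀ s ∈ Set.Icc t t', p ^ 3 - p < meanForce ν u s)
    (h : p ≤ u x t) : p ≤ u x t' := by
  refine image_le_of_deriv_right_lt_deriv_boundary' (B := u x) (a := t) (b := t')
    (f := fun _ => p) (f' := fun _ => 0) continuousOn_const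
    (fun s _ => hasDerivWithinAt_const _ _ _) h
    ((hu.continuousOn x).mono fun s hs => ht.trans hs.1)
    (fun s hs => (hu.hasDerivWithinAt x (ht.trans hs.1)).mono
      (Set.Ici_subset_Ici.mpr (ht.trans hs.1))) (fun s hs hsp => ?_) (Set.right_mem_Icc.mpr htt')
  have := hp s (Set.Ico_subset_Icc_self hs)
  simp only [← hsp]
  linarith

theorem exists_cubic_ne {a b : ℝ} (hab : a < b) (s : ℝ) :
    ∃ p, a < p ∧ p < b ∧ p ^ 3 - p ≠ s := by
  by_contra! H
  obtain ⟨h, hh, hb⟩ : ∃ h : ℝ, 0 < h ∧ a + 5 * h = b := ⟨(b - a) / 5, by linarith, by ring⟩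
  have h1 := H (a + h) (by linarith) (by linarith)
  have h2 := H (a + 2 * h) (by linarith) (by linarith)
  have h3 := H (a + 3 * h) (by linarith) (by linarith)
  have h4 := H (a + 4 * h) (by linarith) (by linarith)
  -- The third difference of a monic cubic with step `h` is `6 h³`.
  have : 6 * h ^ 3 = 0 := by linear_combination h4 - 3 * h3 + 3 * h2 - h1
  have : 0 < h ^ 3 := by positivity
  linarith

/-- Otherwise a trajectory would cross some level `p` with `p ^ 3 - p ≠ s` in both directions
forever, but eventually the velocity at `p` has a fixed sign. -/
theorem exists_tendsto_of_tendsto_meanForce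
    (hu : IsBoundedSolution ν (fun v : ℝ => v ^ 3 - v) u) {s : ℝ}
    (hs : Tendsto (meanForce ν u) atTop (𝓝 s)) (x : Ω) : ∃ c, Tendsto (u x) atTop (𝓝 c) := by
  obtain ⟨M, -, hM⟩ := hu.exists_bound
  refine tendsto_of_no_upcrossings dense_univ (fun a _ b _ hab => ?_)
    ⟨M, ?_⟩ ⟨-M, ?_⟩
  · rintro ⟨ha, hb⟩
    obtain ⟨p, hap, hpb, hp⟩ := exists_cubic_ne hab s
    rcases hp.lt_or_gt with hlt | hgt
    · obtain ⟨T, hT⟩ := eventually_atTop.mp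
        ((hs.eventually_const_lt hlt).and (eventually_ge_atTop 0))
      obtain ⟨t, ht, hbt⟩ := (frequently_atTop.mp hb) T
      obtain ⟨t', ht', hat⟩ := (frequently_atTop.mp ha) t
      have := hu.le_of_lt_meanForce x (p := p) (hT t ht).2 ht'
        (fun r hr => (hT r (ht.trans hr.1)).1) (hpb.trans hbt).le
      linarith
    · obtain ⟨T, hT⟩ := eventually_atTop.mp
        ((hs.eventually_lt_const hgt).and (eventually_ge_atTop 0))
      obtain ⟨t, ht, hat⟩ := (frequently_atTop.mp ha) T
      obtain ⟨t', ht', hbt⟩ := (frequently_atTop.mp hb) t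
      have := hu.le_of_meanForce_lt x (p := p) (hT t ht).2 ht'
        (fun r hr => (hT r (ht.trans hr.1)).1) (hat.trans hap).le
      linarith
  · rw [eventually_map]
    filter_upwards [eventually_ge_atTop 0] with t ht using (abs_le.mp (hM x t ht)).2
  · rw [eventually_map]
    filter_upwards [eventually_ge_atTop 0] with t ht using (abs_le.mp (hM x t ht)).1

theorem convergesInL2_of_tendsto_meanForce [IsProbabilityMeasure ν]
    (hu : IsBoundedSolution ν (fun v : ℝ => v ^ 3 - v) u) {s : ℝ}
    (hs : Tendsto (meanForce ν u) atTop (𝓝 s)) : ConvergesInL2 ν u := by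
  obtain ⟨M, hM1, hM⟩ := hu.exists_bound
  choose g hg using hu.exists_tendsto_of_tendsto_meanForce hs
  -- Integer times suffice, and give a countable limit.
  have hgm : Measurable g :=
    measurable_of_tendsto_metrizable (f := fun (n : ℕ) x => u x (n : ℝ))
      (fun n => hu.measurable n n.cast_nonneg)
      (tendsto_pi_nhds.mpr fun x => (hg x).comp tendsto_natCast_atTop_atTop)
  have hgb : ∀ x, |g x| ≤ M := fun x => le_of_tendsto (hg x).abs (by
    filter_upwards [eventually_ge_atTop 0] with t ht using hM x t ht)
  refine ⟨g, MemLp.of_bound hgm.aestronglyMeasurable M (ae_of_all _ hgb), ?_⟩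
  have key : Tendsto (fun t => ∫⁻ x, ‖u x t - g x‖ₑ ^ (2 : ℝ) ∂ν) atTop (𝓝 0) := by
    have h := tendsto_lintegral_filter_of_dominated_convergence (μ := ν) (l := (atTop : Filter ℝ))
      (F := fun t x => ‖u x t - g x‖ₑ ^ (2 : ℝ)) (f := fun _ => 0)
      (fun _ => ENNReal.ofReal (2 * M) ^ (2 : ℝ)) ?_ ?_ ?_ ?_
    · simpa using h
    · filter_upwards [eventually_ge_atTop 0] with t ht
      exact ((hu.measurable t ht).sub hgm).enorm.pow_const _
    · filter_upwards [eventually_ge_atTop 0] with t ht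
      refine ae_of_all _ fun x => ?_
      gcongr
      rw [← ofReal_norm]
      refine ENNReal.ofReal_le_ofReal ((abs_sub _ _).trans ?_)
      linarith [hM x t ht, hgb x]
    · simp [ENNReal.mul_eq_top]
    · refine ae_of_all _ fun x => ?_
      have h1 : Tendsto (fun t => ‖u x t - g x‖ₑ) atTop (𝓝 ‖g x - g x‖ₑ) :=
        ((hg x).sub_const (g x)).enorm
      have h2 := (ENNReal.continuous_rpow_const (y := 2)).tendsto _ |>.comp h1
      simpa [Function.comp_def] using h2
  have h2 := (ENNReal.continuous_rpow_const (y := 1 / 2)).tendsto _ |>.comp key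
  simp only [one_div, ENNReal.zero_rpow_of_pos (show (0 : ℝ) < 2⁻¹ by norm_num)] at h2
  refine h2.congr fun t => ?_
  rw [eLpNorm_eq_lintegral_rpow_enorm_toReal (by norm_num) (by norm_num)]
  simp

/-- If there is no convergence in `L²`, then the mean force oscillates. -/
theorem exists_frequently_lt_of_not_convergesInL2 [IsProbabilityMeasure ν]
    (hu : IsBoundedSolution ν (fun v : ℝ => v ^ 3 - v) u) (hnc : ¬ ConvergesInL2 ν u) :
    ∃ a b, a < b ∧ (∃ᶠ t in atTop, meanForce ν u t < a) ∧ ∃ᶠ t in atTop, b < meanForce ν u t := by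
  by_contra! H
  obtain ⟨B, -, hB⟩ := hu.exists_bound_integral continuous_cubic
  obtain ⟨c, hc⟩ := tendsto_of_no_upcrossings (u := meanForce ν u) (f := atTop) dense_univ
    (fun a _ b _ hab h => h.2 ((H a b hab h.1).mono fun _ => not_lt.mpr))
    ⟨B, by
      rw [eventually_map]
      filter_upwards [eventually_ge_atTop 0] with t ht using (abs_le.mp (hB t ht)).2⟩
    ⟨-B, by
      rw [eventually_map]
      filter_upwards [eventually_ge_atTop 0] with t ht using (abs_le.mp (hB t ht)).1⟩
  exact hnc (hu.convergesInL2_of_tendsto_meanForce hc)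

end IsBoundedSolution

end Order

/-! ### Level crossings of an oscillating continuous function -/

section Crossing

theorem frequently_eq_of_frequently_lt {σ : ℝ → ℝ} (hσ : ContinuousOn σ (Set.Ici 0)) {a b s : ℝ}
    (ha : ∃ᶠ t in atTop, σ t < a) (hb : ∃ᶠ t in atTop, b < σ t) (has : a ≤ s) (hsb : s ≤ b) :
    ∃ᶠ t in atTop, σ t = s := by
  rw [frequently_atTop] at ha hb ⊢
  intro T
  obtain ⟨t, ht, hta⟩ := ha (max T 0)
  obtain ⟨t', ht', htb⟩ := hb t
  have ht0 : 0 ≤ t := (le_max_right _ _).trans ht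
  obtain ⟨r, hr, hrs⟩ := intermediate_value_Icc ht' (hσ.mono fun x hx => ht0.trans hx.1)
    ⟨(hta.trans_le has).le, hsb.trans htb.le⟩
  exact ⟨r, (le_max_left _ _).trans (ht.trans hr.1), hrs⟩

/-- Upcrossings that stay below the upper level. -/
theorem exists_upcrossing {σ : ℝ → ℝ} (hσ : ContinuousOn σ (Set.Ici 0)) {s s' : ℝ} (hss' : s < s')
    (hs : ∃ᶠ t in atTop, σ t = s) (hs' : ∃ᶠ t in atTop, σ t = s') (T : ℝ) :
    ∃ t t', T ≤ t ∧ 0 ≤ t ∧ t ≤ t' ∧ σ t = s ∧ σ t' = s' ∧ ∀ r ∈ Set.Icc t t', σ r ≤ s' := by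
  rw [frequently_atTop] at hs hs'
  obtain ⟨t, ht, hts⟩ := hs (max T 0)
  obtain ⟨t₁, ht₁, hts₁⟩ := hs' t
  have ht0 : 0 ≤ t := (le_max_right _ _).trans ht
  have hc : ContinuousOn σ (Set.Icc t t₁) := hσ.mono fun x hx => ht0.trans hx.1
  have hcomp : IsCompact (Set.Icc t t₁ ∩ σ ⁻¹' {s'}) :=
    isCompact_Icc.of_isClosed_subset (hc.preimage_isClosed_of_isClosed isClosed_Icc
      isClosed_singleton) Set.inter_subset_left
  -- The first hitting time of `s'` after `t`: exceeding `s'` earlier would force an earlier hit.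
  obtain ⟨t', ⟨ht'1, ht'2⟩, hleast⟩ := hcomp.exists_isLeast ⟨t₁, ⟨ht₁, le_rfl⟩, hts₁⟩
  refine ⟨t, t', (le_max_left _ _).trans ht, ht0, ht'1.1, hts, ht'2, fun r hr => ?_⟩
  by_contra! hlt
  obtain ⟨q, hq, hqs⟩ := intermediate_value_Icc hr.1
    (hc.mono (Set.Icc_subset_Icc_right (hr.2.trans ht'1.2))) ⟨by rw [hts]; exact hss'.le, hlt.le⟩
  have h1 : t' ≤ q := hleast ⟨⟨hq.1, hq.2.trans (hr.2.trans ht'1.2)⟩, hqs⟩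
  have h2 : r = t' := le_antisymm hr.2 (h1.trans hq.2)
  rw [h2] at hlt
  exact hlt.ne' ht'2

/-- Downcrossings that stay below the upper level. -/
theorem exists_downcrossing {σ : ℝ → ℝ} (hσ : ContinuousOn σ (Set.Ici 0)) {s s' : ℝ}
    (hss' : s < s') (hs : ∃ᶠ t in atTop, σ t = s) (hs' : ∃ᶠ t in atTop, σ t = s') (T : ℝ) :
    ∃ t t', T ≤ t ∧ 0 ≤ t ∧ t ≤ t' ∧ σ t = s' ∧ σ t' = s ∧ ∀ r ∈ Set.Icc t t', σ r ≤ s' := by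
  rw [frequently_atTop] at hs hs'
  obtain ⟨t, ht, hts⟩ := hs' (max T 0)
  obtain ⟨t₁, ht₁, hts₁⟩ := hs t
  have ht0 : 0 ≤ t := (le_max_right _ _).trans ht
  have hc : ContinuousOn σ (Set.Icc t t₁) := hσ.mono fun x hx => ht0.trans hx.1
  have hcomp : IsCompact (Set.Icc t t₁ ∩ σ ⁻¹' {s'}) :=
    isCompact_Icc.of_isClosed_subset (hc.preimage_isClosed_of_isClosed isClosed_Icc
      isClosed_singleton) Set.inter_subset_left
  -- The last visit to `s'` before `t₁`.
  obtain ⟨t', ⟨ht'1, ht'2⟩, hgr⟩ := hcomp.exists_isGreatest ⟨t, ⟨le_rfl, ht₁⟩, hts⟩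
  refine ⟨t', t₁, (le_max_left _ _).trans (ht.trans ht'1.1), ht0.trans ht'1.1, ht'1.2, ht'2, hts₁,
    fun r hr => ?_⟩
  by_contra! hlt
  obtain ⟨q, hq, hqs⟩ := intermediate_value_Icc' hr.2
    (hc.mono (Set.Icc_subset_Icc_left (ht'1.1.trans hr.1))) ⟨by rw [hts₁]; exact hss'.le, hlt.le⟩
  have h1 : q ≤ t' := hgr ⟨⟨ht'1.1.trans (hr.1.trans hq.1), hq.2⟩, hqs⟩
  have h2 : r = t' := le_antisymm (hq.1.trans h1) hr.1
  rw [h2] at hlt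
  exact hlt.ne' ht'2

end Crossing

/-! ### Masses of the cells around the roots -/

section Cells

/-- Comparison of the indicator of a cell containing the root `r` of `v ^ 3 - v = s` (and no other
root) with the Lagrange interpolation polynomial at that root. -/
theorem abs_indicator_sub_le {S : Set ℝ} {r δ M v : ℝ} (hδ : 0 < δ)
    (hin : ∀ v ∈ S, δ ≤ |v ^ 2 + v * r + r ^ 2 - 1|) (hout : ∀ v ∉ S, δ ≤ |v - r|)
    (hr : 3 * r ^ 2 - 1 ≠ 0) (hv : |v| ≤ M) :
    |S.indicator 1 v - (v ^ 2 + v * r + r ^ 2 - 1) / (3 * r ^ 2 - 1)| ≤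
      (M + 2 * |r| + 1) / (δ * |3 * r ^ 2 - 1|) * |v ^ 3 - v - (r ^ 3 - r)| := by
  have hM : 0 ≤ M := (abs_nonneg v).trans hv
  have hr' : 0 < |3 * r ^ 2 - 1| := abs_pos.mpr hr
  have hfac : |v ^ 3 - v - (r ^ 3 - r)| = |v - r| * |v ^ 2 + v * r + r ^ 2 - 1| := by
    rw [← abs_mul]; congr 1; ring
  rw [div_mul_eq_mul_div, le_div_iff₀ (by positivity), hfac]
  by_cases h : v ∈ S
  -- In the cell the error carries the factor `v - r`, while the cofactor is at least `δ`. Outside,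
  -- the roles are exchanged.
  · have e : S.indicator (1 : ℝ → ℝ) v - (v ^ 2 + v * r + r ^ 2 - 1) / (3 * r ^ 2 - 1) =
        -((v - r) * (v + 2 * r)) / (3 * r ^ 2 - 1) := by
      rw [Set.indicator_of_mem h, Pi.one_apply, eq_div_iff hr, sub_mul, div_mul_cancel₀ _ hr]
      ring
    rw [e, abs_div, abs_neg, abs_mul, mul_comm δ, ← mul_assoc, div_mul_cancel₀ _ hr'.ne']
    have h1 : |v + 2 * r| ≤ M + 2 * |r| + 1 := by
      have := abs_add_le v (2 * r)
      rw [abs_mul, abs_two] at this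
      linarith
    calc |v - r| * |v + 2 * r| * δ
        ≤ |v - r| * (M + 2 * |r| + 1) * |v ^ 2 + v * r + r ^ 2 - 1| := by
          gcongr; exact hin v h
      _ = _ := by ring
  · rw [Set.indicator_of_notMem h, zero_sub, abs_neg, abs_div, mul_comm δ, ← mul_assoc,
      div_mul_cancel₀ _ hr'.ne']
    have h1 : (1 : ℝ) ≤ M + 2 * |r| + 1 := by linarith [abs_nonneg r]
    calc |v ^ 2 + v * r + r ^ 2 - 1| * δ
        ≤ 1 * (|v - r| * |v ^ 2 + v * r + r ^ 2 - 1|) := by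
          rw [one_mul, mul_comm]; gcongr; exact hout v h
      _ ≤ _ := by gcongr

theorem exists_cubic_eq {a b s : ℝ} (hab : a ≤ b)
    (h : s ∈ Set.Ioo (a ^ 3 - a) (b ^ 3 - b) ∨ s ∈ Set.Ioo (b ^ 3 - b) (a ^ 3 - a)) :
    ∃ r ∈ Set.Ioo a b, r ^ 3 - r = s := by
  have hc : ContinuousOn (fun v : ℝ => v ^ 3 - v) (Set.Icc a b) := by fun_prop
  rcases h with h | h
  · exact intermediate_value_Ioo hab hc h
  · exact intermediate_value_Ioo' hab hc h

variable {w : ℝ}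

/-- Here `w = 1/√3` is the positive critical point; at `-2w`, `-w`, `w`, `2w` the cubic alternates
between `-2w/3` and `2w/3`. -/
theorem exists_three_roots (hw0 : 0 < w) (hw : 3 * w ^ 2 = 1) {s : ℝ} (h1 : -(2 * w / 3) < s)
    (h2 : s < 2 * w / 3) :
    (∃ r ∈ Set.Ioo (-2 * w) (-w), r ^ 3 - r = s) ∧ (∃ r ∈ Set.Ioo (-w) w, r ^ 3 - r = s) ∧
      ∃ r ∈ Set.Ioo w (2 * w), r ^ 3 - r = s := by
  have hw3 : w ^ 3 = w / 3 := by linear_combination w / 3 * hw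
  refine ⟨exists_cubic_eq (by linarith) (Or.inl ⟨?_, ?_⟩),
    exists_cubic_eq (by linarith) (Or.inr ⟨?_, ?_⟩),
    exists_cubic_eq (by linarith) (Or.inl ⟨?_, ?_⟩)⟩ <;> ring_nf <;> rw [hw3] <;> linarith

theorem cell_bottom (hw : 3 * w ^ 2 = 1) (hw0 : 0 < w) {r : ℝ} (hr : r < -w) :
    ∃ δ > 0, (∀ v ∈ Set.Iic (-w), δ ≤ |v ^ 2 + v * r + r ^ 2 - 1|) ∧
      (∀ v ∉ Set.Iic (-w), δ ≤ |v - r|) ∧ 3 * r ^ 2 - 1 ≠ 0 := by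
  have hpos : 0 < (r - 2 * w) * (r + w) := mul_pos_of_neg_of_neg (by linarith) (by linarith)
  -- The cofactor is decreasing in `v` on the cell; the first entry is its value at the endpoint
  -- `-w`.
  refine ⟨min ((r - 2 * w) * (r + w)) (-w - r), lt_min hpos (by linarith), fun v hv => ?_,
    fun v hv => ?_, ?_⟩
  · refine (min_le_left _ _).trans (le_trans ?_ (le_abs_self _))
    have hv : v ≤ -w := hv
    have : 0 ≤ (v + w) * (v - w + r) := mul_nonneg_of_nonpos_of_nonpos (by linarith) (by linarith)
    linear_combination this - hw
  · have hv : -w < v := not_le.mp hv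
    exact (min_le_right _ _).trans (le_trans (by linarith) (le_abs_self _))
  · have : 0 < (r - w) * (r + w) := mul_pos_of_neg_of_neg (by linarith) (by linarith)
    intro h
    linarith [show 3 * ((r - w) * (r + w)) = 0 by linear_combination h - hw]

theorem cell_top (hw : 3 * w ^ 2 = 1) (hw0 : 0 < w) {r : ℝ} (hr : w < r) :
    ∃ δ > 0, (∀ v ∈ Set.Ici w, δ ≤ |v ^ 2 + v * r + r ^ 2 - 1|) ∧
      (∀ v ∉ Set.Ici w, δ ≤ |v - r|) ∧ 3 * r ^ 2 - 1 ≠ 0 := by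
  obtain ⟨δ, hδ, h1, h2, h3⟩ := cell_bottom hw hw0 (r := -r) (by linarith)
  refine ⟨δ, hδ, fun v hv => ?_, fun v hv => ?_, ?_⟩
  · have := h1 (-v) (Set.mem_Iic.mpr (neg_le_neg hv))
    rwa [show (-v) ^ 2 + -v * -r + (-r) ^ 2 - 1 = v ^ 2 + v * r + r ^ 2 - 1 by ring] at this
  · have := h2 (-v) fun h => hv (Set.mem_Ici.mpr (neg_le_neg_iff.mp h))
    rwa [show -v - -r = -(v - r) by ring, abs_neg] at this
  · rwa [neg_sq] at h3

/-- Three distinct negative solutions of `m r³ + r² + κ = p (3 r² - 1)` force all the coefficients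
to vanish. -/
theorem coeff_eq_of_three_roots {m κ p r₁ r₂ r₃ : ℝ} (h12 : r₁ ≠ r₂) (h13 : r₁ ≠ r₃)
    (h23 : r₂ ≠ r₃) (hr₁ : r₁ < 0) (hr₂ : r₂ < 0) (hr₃ : r₃ < 0)
    (h₁ : m * r₁ ^ 3 + r₁ ^ 2 + κ = p * (3 * r₁ ^ 2 - 1))
    (h₂ : m * r₂ ^ 3 + r₂ ^ 2 + κ = p * (3 * r₂ ^ 2 - 1))
    (h₃ : m * r₃ ^ 3 + r₃ ^ 2 + κ = p * (3 * r₃ ^ 2 - 1)) : m = 0 ∧ κ = -(1 / 3) := by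
  have a : m * (r₁ ^ 2 + r₁ * r₂ + r₂ ^ 2) + (1 - 3 * p) * (r₁ + r₂) = 0 :=
    mul_left_cancel₀ (sub_ne_zero.mpr h12) (by linear_combination h₁ - h₂)
  have b : m * (r₁ ^ 2 + r₁ * r₃ + r₃ ^ 2) + (1 - 3 * p) * (r₁ + r₃) = 0 :=
    mul_left_cancel₀ (sub_ne_zero.mpr h13) (by linear_combination h₁ - h₃)
  have c : m * (r₁ + r₂ + r₃) + (1 - 3 * p) = 0 :=
    mul_left_cancel₀ (sub_ne_zero.mpr h23) (by linear_combination a - b)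
  -- Vieta: the cubic has no linear term.
  have d : m * (r₁ * r₂ + r₁ * r₃ + r₂ * r₃) = 0 := by
    linear_combination (r₁ + r₂) * c - a
  have e : 0 < r₁ * r₂ + r₁ * r₃ + r₂ * r₃ := by
    linarith [mul_pos_of_neg_of_neg hr₁ hr₂, mul_pos_of_neg_of_neg hr₁ hr₃,
      mul_pos_of_neg_of_neg hr₂ hr₃]
  have hm : m = 0 := (mul_eq_zero.mp d).resolve_right e.ne'
  subst hm
  have hp : p = 1 / 3 := by linarith
  subst hp
  exact ⟨rfl, by linarith⟩

namespace IsBoundedSolution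

variable {Ω : Type*} [MeasurableSpace Ω] {ν : Measure Ω} {u : Ω → ℝ → ℝ} [IsProbabilityMeasure ν]

/-- The interpolation polynomial is quadratic, so its mean needs only the conserved mean and the
second moment, which is known asymptotically. -/
theorem tendsto_measureReal_cell (hu : IsBoundedSolution ν (fun v : ℝ => v ^ 3 - v) u)
    {S : Set ℝ} (hS : MeasurableSet S) {r e : ℝ}
    (hcell : ∃ δ > 0, (∀ v ∈ S, δ ≤ |v ^ 2 + v * r + r ^ 2 - 1|) ∧ (∀ v ∉ S, δ ≤ |v - r|) ∧
      3 * r ^ 2 - 1 ≠ 0)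
    (he : Tendsto (fun t => ∫ x, (u x t) ^ 2 ∂ν - meanForce ν u t * ∫ x, u x 0 ∂ν) atTop (𝓝 e)) :
    Tendsto (fun t => ν.real {x | u x t ∈ S}) (atTop ⊓ 𝓟 {t | meanForce ν u t = r ^ 3 - r})
      (𝓝 (((∫ x, u x 0 ∂ν) * r ^ 3 + r ^ 2 + (e - 1)) / (3 * r ^ 2 - 1))) := by
  obtain ⟨δ, hδ, hin, hout, hr⟩ := hcell
  obtain ⟨M, hM1, hM⟩ := hu.exists_bound
  set l := (atTop : Filter ℝ) ⊓ 𝓟 {t | meanForce ν u t = r ^ 3 - r}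
  have hl : l ≤ atTop := inf_le_left
  have hs : ∀ᶠ t in l, meanForce ν u t = r ^ 3 - r := mem_inf_of_right (mem_principal_self _)
  have h1 := hu.tendsto_integral_of_abs_le hl
    (C := (M + 2 * |r| + 1) / (δ * |3 * r ^ 2 - 1|))
    (g := fun x t => S.indicator 1 (u x t) -
      ((u x t) ^ 2 + u x t * r + r ^ 2 - 1) / (3 * r ^ 2 - 1)) (by
      filter_upwards [hs, hl (eventually_ge_atTop 0)] with t ht ht0 x
      rw [ht]
      exact abs_indicator_sub_le hδ hin hout hr (hM x t ht0))
  set m := ∫ x, u x 0 ∂ν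
  have h2 : Tendsto (fun t => ((∫ x, (u x t) ^ 2 ∂ν - meanForce ν u t * m) +
      (m * r ^ 3 + r ^ 2 - 1)) / (3 * r ^ 2 - 1)) l
      (𝓝 ((e + (m * r ^ 3 + r ^ 2 - 1)) / (3 * r ^ 2 - 1))) :=
    ((he.mono_left hl).add_const _).div_const _
  have h3 := h1.add h2
  rw [show 0 + (e + (m * r ^ 3 + r ^ 2 - 1)) / (3 * r ^ 2 - 1) =
    (m * r ^ 3 + r ^ 2 + (e - 1)) / (3 * r ^ 2 - 1) by ring] at h3
  refine h3.congr' ?_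
  filter_upwards [hs, hl (eventually_ge_atTop 0)] with t ht ht0
  have hmS : MeasurableSet {x | u x t ∈ S} := hu.measurable t ht0 hS
  have i1 : Integrable (fun x => S.indicator (1 : ℝ → ℝ) (u x t)) ν :=
    (integrable_const (1 : ℝ)).indicator hmS
  have i2 := hu.integrable_comp (φ := fun v => (v ^ 2 + v * r + r ^ 2 - 1) / (3 * r ^ 2 - 1))
    (by fun_prop) ht0
  have j1 := hu.integrable_comp (φ := fun v => v) continuous_id ht0
  have j2 := hu.integrable_comp (φ := fun v => v ^ 2) (by fun_prop) ht0
  have e1 : ∫ x, S.indicator (1 : ℝ → ℝ) (u x t) ∂ν = ν.real {x | u x t ∈ S} := by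
    rw [← integral_indicator_one hmS]; rfl
  have e2 : ∫ x, ((u x t) ^ 2 + u x t * r + r ^ 2 - 1) / (3 * r ^ 2 - 1) ∂ν =
      (∫ x, (u x t) ^ 2 ∂ν + m * r + r ^ 2 - 1) / (3 * r ^ 2 - 1) := by
    rw [integral_div, integral_sub (f := fun x => (u x t) ^ 2 + u x t * r + r ^ 2)
      ((j2.add (j1.mul_const r)).add (integrable_const _)) (integrable_const _),
      integral_add (f := fun x => (u x t) ^ 2 + u x t * r) (j2.add (j1.mul_const r))
      (integrable_const _), integral_add j2 (j1.mul_const r), integral_mul_const, hu.integral_eq ht0]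
    simp [m]
  rw [integral_sub i1 i2, e1, e2, ht]
  ring

/-- If the mean force repeatedly takes a value `s` for which `v ^ 3 - v = s` has a single root,
then this root is the conserved mean. -/
theorem cubic_integral_eq_of_frequently (hu : IsBoundedSolution ν (fun v : ℝ => v ^ 3 - v) u)
    (hw0 : 0 < w) (hw : 3 * w ^ 2 = 1) {s : ℝ} (hs : 2 * w / 3 < |s|)
    (hfreq : ∃ᶠ t in atTop, meanForce ν u t = s) :
    (∫ x, u x 0 ∂ν) ^ 3 - ∫ x, u x 0 ∂ν = s := by
  have hw3 : w ^ 3 = w / 3 := by linear_combination w / 3 * hw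
  obtain ⟨r, -, hr⟩ : ∃ r ∈ Set.Ioo (-(|s| + 2)) (|s| + 2), r ^ 3 - r = s := by
    have h0 := abs_nonneg s
    have h1 : |s| < (|s| + 2) ^ 3 - (|s| + 2) := by
      nlinarith [mul_nonneg h0 h0, mul_nonneg h0 (mul_nonneg h0 h0)]
    refine exists_cubic_eq (by linarith) (Or.inl ⟨?_, ?_⟩)
    · have := neg_abs_le s
      rw [show (-(|s| + 2)) ^ 3 - -(|s| + 2) = -((|s| + 2) ^ 3 - (|s| + 2)) by ring]
      linarith
    · linarith [le_abs_self s]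
  -- This bounds the cofactor `(v + r / 2)² + (3 / 4 * r² - 1)` below. It holds since `f(r) ∓ 2w/3 =
  -- (r ± w)² (r ∓ 2w)`, so `|s| > 2w/3` forces `|r| > 2w`.
  have hr2 : 0 < 3 / 4 * r ^ 2 - 1 := by
    have : 2 * w < |r| := by
      rcases lt_abs.mp hs with h | h
      · refine lt_of_lt_of_le ?_ (le_abs_self r)
        by_contra! hle
        linarith [show (r + w) ^ 2 * (r - 2 * w) ≤ 0 from
            mul_nonpos_of_nonneg_of_nonpos (sq_nonneg _) (by linarith),
          show (r + w) ^ 2 * (r - 2 * w) = s - 2 * w / 3 by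
            linear_combination hr - r * hw - 2 * hw3]
      · refine lt_of_lt_of_le ?_ (neg_le_abs r)
        by_contra! hle
        linarith [show 0 ≤ (r - w) ^ 2 * (r + 2 * w) from
            mul_nonneg (sq_nonneg _) (by linarith),
          show (r - w) ^ 2 * (r + 2 * w) = s + 2 * w / 3 by
            linear_combination hr - r * hw + 2 * hw3]
    have h2 : (2 * w) ^ 2 < |r| ^ 2 := by gcongr
    rw [sq_abs] at h2
    linarith
  set l := (atTop : Filter ℝ) ⊓ 𝓟 {t | meanForce ν u t = s}
  have hl : l ≤ atTop := inf_le_left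
  have hls : ∀ᶠ t in l, meanForce ν u t = s := mem_inf_of_right (mem_principal_self _)
  have hne : NeBot l := frequently_mem_iff_neBot.mp hfreq
  have h1 := hu.tendsto_integral_of_abs_le hl (C := (3 / 4 * r ^ 2 - 1)⁻¹)
    (g := fun x t => u x t - r) (by
      filter_upwards [hls] with t ht x
      rw [ht, ← hr, inv_mul_eq_div, le_div_iff₀ hr2, show (u x t) ^ 3 - u x t - (r ^ 3 - r) =
        (u x t - r) * ((u x t) ^ 2 + u x t * r + r ^ 2 - 1) by ring, abs_mul]
      gcongr
      refine le_trans ?_ (le_abs_self _)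
      linarith [sq_nonneg (u x t + r / 2), show (u x t) ^ 2 + u x t * r + r ^ 2 - 1 =
        (u x t + r / 2) ^ 2 + (3 / 4 * r ^ 2 - 1) by ring])
  have h2 : Tendsto (fun _ : ℝ => ∫ x, u x 0 ∂ν - r) l (𝓝 0) := by
    refine h1.congr' ?_
    filter_upwards [hl (eventually_ge_atTop 0)] with t ht
    rw [integral_sub (hu.integrable_comp (φ := fun v => v) continuous_id ht) (integrable_const _)]
    simp [hu.integral_eq ht]
  have h3 : ∫ x, u x 0 ∂ν = r := by
    linarith [tendsto_nhds_unique h2 tendsto_const_nhds]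
  rw [h3, hr]

/-- Along an oscillation, the mean force sweeps an interval where `v ^ 3 - v = s` has three
roots. -/
theorem exists_interval (hu : IsBoundedSolution ν (fun v : ℝ => v ^ 3 - v) u)
    (hw0 : 0 < w) (hw : 3 * w ^ 2 = 1) (hnc : ¬ ConvergesInL2 ν u) :
    ∃ a b, a < b ∧ ∀ s, a < s → s < b →
      -(2 * w / 3) < s ∧ s < 2 * w / 3 ∧ ∃ᶠ t in atTop, meanForce ν u t = s := by
  obtain ⟨a, b, hab, ha, hb⟩ := hu.exists_frequently_lt_of_not_convergesInL2 hnc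
  have hfr : ∀ s, a ≤ s → s ≤ b → ∃ᶠ t in atTop, meanForce ν u t = s := fun s h1 h2 =>
    frequently_eq_of_frequently_lt hu.continuousOn_meanForce ha hb h1 h2
  rcases lt_or_ge (max a (-(2 * w / 3))) (min b (2 * w / 3)) with h | h
  · refine ⟨_, _, h, fun s h1 h2 => ?_⟩
    obtain ⟨h1, h1'⟩ := max_lt_iff.mp h1
    obtain ⟨h2, h2'⟩ := lt_min_iff.mp h2
    exact ⟨h1', h2', hfr s h1.le h2.le⟩
  · exfalso
    -- Two different values would both be the cubic of the conserved mean.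
    have key : ∀ s s', a ≤ s → s < s' → s' ≤ b → 2 * w / 3 < |s| → 2 * w / 3 < |s'| → False :=
      fun s s' h1 h2 h3 h4 h5 => by
        have e1 := hu.cubic_integral_eq_of_frequently hw0 hw h4 (hfr s h1 (h2.le.trans h3))
        have e2 := hu.cubic_integral_eq_of_frequently hw0 hw h5 (hfr s' (h1.trans h2.le) h3)
        linarith
    rcases min_le_iff.mp h with h | h <;> rcases le_max_iff.mp h with h | h
    · linarith
    · refine key a ((a + b) / 2) le_rfl (by linarith) (by linarith) ?_ ?_ <;>
        refine lt_of_lt_of_le ?_ (neg_le_abs _) <;> linarith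
    · refine key ((a + b) / 2) b (by linarith) (by linarith) le_rfl ?_ ?_ <;>
        refine lt_of_lt_of_le ?_ (le_abs_self _) <;> linarith
    · linarith

/-- The cubic equals `2w/3` at `-w`, so a mean force below this lets trajectories cross `-w` only
downwards. -/
theorem measureReal_bottom_mono (hu : IsBoundedSolution ν (fun v : ℝ => v ^ 3 - v) u)
    (hw : 3 * w ^ 2 = 1) {t t' s : ℝ} (ht : 0 ≤ t) (htt' : t ≤ t') (hs : s < 2 * w / 3)
    (h : ∀ r ∈ Set.Icc t t', meanForce ν u r ≤ s) :
    ν.real {x | u x t ∈ Set.Iic (-w)} ≤ ν.real {x | u x t' ∈ Set.Iic (-w)} := by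
  refine measureReal_mono fun x hx => ?_
  refine hu.le_of_meanForce_lt x ht htt' (fun r hr => ?_) hx
  rw [show (-w) ^ 3 - -w = 2 * w / 3 by linear_combination -w / 3 * hw]
  exact (h r hr).trans_lt hs

/-- The limit mass of the bottom cell does not depend on the value of the mean force. -/
theorem bottom_limit_eq (hu : IsBoundedSolution ν (fun v : ℝ => v ^ 3 - v) u)
    (hw : 3 * w ^ 2 = 1) {s s' p p' : ℝ} (hss' : s < s') (hs' : s' < 2 * w / 3)
    (hf : ∃ᶠ t in atTop, meanForce ν u t = s) (hf' : ∃ᶠ t in atTop, meanForce ν u t = s')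
    (hp : Tendsto (fun t => ν.real {x | u x t ∈ Set.Iic (-w)})
      (atTop ⊓ 𝓟 {t | meanForce ν u t = s}) (𝓝 p))
    (hp' : Tendsto (fun t => ν.real {x | u x t ∈ Set.Iic (-w)})
      (atTop ⊓ 𝓟 {t | meanForce ν u t = s'}) (𝓝 p')) : p = p' := by
  refine le_antisymm (le_of_not_gt fun hlt => ?_) (le_of_not_gt fun hlt => ?_)
  -- The mass cannot fall during an upcrossing from `s` to `s'`, nor, in the second case, during a
  -- downcrossing.
  · obtain ⟨c, hc1, hc2⟩ := exists_between hlt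
    obtain ⟨T, hT⟩ := eventually_atTop.mp ((eventually_inf_principal.mp
      (hp.eventually_const_lt hc2)).and (eventually_inf_principal.mp (hp'.eventually_lt_const hc1)))
    obtain ⟨t, t', hTt, ht0, htt', e, e', h⟩ :=
      exists_upcrossing hu.continuousOn_meanForce hss' hf hf' T
    have h1 := (hT t hTt).1 e
    have h2 := (hT t' (hTt.trans htt')).2 e'
    linarith [hu.measureReal_bottom_mono hw ht0 htt' hs' h]
  · obtain ⟨c, hc1, hc2⟩ := exists_between hlt
    obtain ⟨T, hT⟩ := eventually_atTop.mp ((eventually_inf_principal.mp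
      (hp.eventually_lt_const hc1)).and (eventually_inf_principal.mp (hp'.eventually_const_lt hc2)))
    obtain ⟨t, t', hTt, ht0, htt', e, e', h⟩ :=
      exists_downcrossing hu.continuousOn_meanForce hss' hf hf' T
    have h1 := (hT t hTt).2 e
    have h2 := (hT t' (hTt.trans htt')).1 e'
    linarith [hu.measureReal_bottom_mono hw ht0 htt' hs' h]

/-- Without convergence, the mean vanishes, and at suitable late times a third of the mass is in
each of the two outer cells. -/
theorem integral_eq_zero_and_exists_level (hu : IsBoundedSolution ν (fun v : ℝ => v ^ 3 - v) u)
    (hw0 : 0 < w) (hw : 3 * w ^ 2 = 1) (hnc : ¬ ConvergesInL2 ν u) :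
    ∫ x, u x 0 ∂ν = 0 ∧ ∃ s, -(2 * w / 3) < s ∧ s < 2 * w / 3 ∧
      (∃ᶠ t in atTop, meanForce ν u t = s) ∧
      Tendsto (fun t => ν.real {x | u x t ∈ Set.Iic (-w)})
        (atTop ⊓ 𝓟 {t | meanForce ν u t = s}) (𝓝 (1 / 3)) ∧
      Tendsto (fun t => ν.real {x | u x t ∈ Set.Ici w})
        (atTop ⊓ 𝓟 {t | meanForce ν u t = s}) (𝓝 (1 / 3)) := by
  obtain ⟨a, b, hab, H⟩ := hu.exists_interval hw0 hw hnc
  obtain ⟨e, he⟩ := hu.exists_tendsto_second_moment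
  set m := ∫ x, u x 0 ∂ν with hm
  have hbot : ∀ s, a < s → s < b → ∃ r, r < -w ∧ r ^ 3 - r = s ∧ 3 * r ^ 2 - 1 ≠ 0 ∧
      Tendsto (fun t => ν.real {x | u x t ∈ Set.Iic (-w)})
        (atTop ⊓ 𝓟 {t | meanForce ν u t = s})
        (𝓝 ((m * r ^ 3 + r ^ 2 + (e - 1)) / (3 * r ^ 2 - 1))) := fun s h1 h2 => by
    obtain ⟨h3, h4, -⟩ := H s h1 h2
    obtain ⟨⟨r, hr, hrs⟩, -, -⟩ := exists_three_roots hw0 hw h3 h4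
    have hc := cell_bottom hw hw0 hr.2
    refine ⟨r, hr.2, hrs, ?_, ?_⟩
    · obtain ⟨_, _, _, _, h⟩ := hc
      exact h
    · rw [← hrs]
      exact hu.tendsto_measureReal_cell measurableSet_Iic hc he
  have heq : ∀ s s', a < s → s < s' → s' < b → ∀ p p',
      Tendsto (fun t => ν.real {x | u x t ∈ Set.Iic (-w)})
        (atTop ⊓ 𝓟 {t | meanForce ν u t = s}) (𝓝 p) →
      Tendsto (fun t => ν.real {x | u x t ∈ Set.Iic (-w)})
        (atTop ⊓ 𝓟 {t | meanForce ν u t = s'}) (𝓝 p') → p = p' :=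
    fun s s' h1 h2 h3 p p' hp hp' => hu.bottom_limit_eq hw h2 (H s' (h1.trans h2) h3).2.1
      (H s h1 (h2.trans h3)).2.2 (H s' (h1.trans h2) h3).2.2 hp hp'
  obtain ⟨s₂, ha2, h2b⟩ := exists_between hab
  obtain ⟨s₁, ha1, h12⟩ := exists_between ha2
  obtain ⟨s₃, h23, h3b⟩ := exists_between h2b
  obtain ⟨r₁, hr₁, e₁, n₁, t₁⟩ := hbot s₁ ha1 (h12.trans h2b)
  obtain ⟨r₂, hr₂, e₂, n₂, t₂⟩ := hbot s₂ ha2 h2b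
  obtain ⟨r₃, hr₃, e₃, n₃, t₃⟩ := hbot s₃ (ha2.trans h23) h3b
  have q12 := heq s₁ s₂ ha1 h12 h2b _ _ t₁ t₂
  have q23 := heq s₂ s₃ ha2 h23 h3b _ _ t₂ t₃
  have ne : ∀ {r r' s s' : ℝ}, r ^ 3 - r = s → r' ^ 3 - r' = s' → s < s' → r ≠ r' := by
    rintro r r' s s' h h' hlt rfl
    linarith
  obtain ⟨hm0, hκ⟩ := coeff_eq_of_three_roots (ne e₁ e₂ h12) (ne e₁ e₃ (h12.trans h23))
    (ne e₂ e₃ h23) (by linarith) (by linarith) (by linarith)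
    (by rw [← div_eq_iff n₁, q12, q23]) (by rw [← div_eq_iff n₂, q23])
    (by rw [← div_eq_iff n₃])
  obtain ⟨h3, h4, h5⟩ := H s₂ ha2 h2b
  obtain ⟨-, -, ⟨r, hr, hrs⟩⟩ := exists_three_roots hw0 hw h3 h4
  have hc := cell_top hw hw0 hr.1
  -- The fraction is now `(r² - 1/3) / (3 r² - 1)`, whatever the root, so the top cell gets the same
  -- mass.
  have third : ∀ {r : ℝ}, 3 * r ^ 2 - 1 ≠ 0 →
      (m * r ^ 3 + r ^ 2 + (e - 1)) / (3 * r ^ 2 - 1) = 1 / 3 := fun {r} h => by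
    rw [div_eq_iff h, hm0, hκ]; ring
  refine ⟨hm0, s₂, h3, h4, h5, third n₂ ▸ t₂, ?_⟩
  have n : 3 * r ^ 2 - 1 ≠ 0 := by
    obtain ⟨_, _, _, _, h⟩ := hc
    exact h
  rw [← third n, ← hrs]
  exact hu.tendsto_measureReal_cell measurableSet_Ici hc he

end IsBoundedSolution

end Cells

/-! ### Borel–Cantelli for chains of sets -/

section Chains

variable {Ω : Type*} [MeasurableSpace Ω] {ν : Measure Ω} [IsProbabilityMeasure ν]

theorem measureReal_symmDiff_of_subset {A B : Set Ω} (hA : MeasurableSet A) (hAB : A ⊆ B) :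
    ν.real (symmDiff A B) = ν.real B - ν.real A := by
  rw [Set.symmDiff_def, Set.sdiff_eq_empty.mpr hAB, Set.empty_union, measureReal_sdiff hAB hA]

/-- A sequence of pairwise comparable sets whose measures converge fast converges almost
everywhere. -/
theorem ae_eventually_mem_or_notMem {L : ℕ → Set Ω} {p : ℝ} (hL : ∀ n, MeasurableSet (L n))
    (hcomp : ∀ n k, L n ⊆ L k ∨ L k ⊆ L n) (hp : ∀ n, |ν.real (L n) - p| ≤ (1 / 2) ^ n) :
    ∀ᵐ x ∂ν, (∀ᶠ n in atTop, x ∈ L n) ∨ ∀ᶠ n in atTop, x ∉ L n := by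
  -- For nested sets the symmetric difference has the difference of the measures as its mass, which
  -- is summable.
  have hle : ∀ n, ν (symmDiff (L n) (L (n + 1))) ≤ ENNReal.ofReal (2 * (1 / 2) ^ n) := fun n => by
    rw [← ofReal_measureReal]
    refine ENNReal.ofReal_le_ofReal ?_
    have h1 := abs_le.mp (hp n)
    have h2 := abs_le.mp (hp (n + 1))
    have h3 : (1 / 2 : ℝ) ^ (n + 1) ≤ (1 / 2) ^ n :=
      pow_le_pow_of_le_one (by norm_num) (by norm_num) n.le_succ
    rcases hcomp n (n + 1) with h | h
    · rw [measureReal_symmDiff_of_subset (hL n) h]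
      linarith
    · rw [symmDiff_comm, measureReal_symmDiff_of_subset (hL _) h]
      linarith
  have hsum : Summable fun n : ℕ => 2 * (1 / 2 : ℝ) ^ n :=
    (summable_geometric_of_lt_one (by norm_num) (by norm_num)).mul_left 2
  have hne : ∑' n, ν (symmDiff (L n) (L (n + 1))) ≠ ∞ :=
    ne_top_of_le_ne_top hsum.tsum_ofReal_ne_top (ENNReal.tsum_le_tsum hle)
  filter_upwards [ae_eventually_notMem hne] with x hx
  obtain ⟨N, hN⟩ := eventually_atTop.mp hx
  have hstep : ∀ n ≥ N, (x ∈ L N ↔ x ∈ L n) := fun n hn => by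
    induction n, hn using Nat.le_induction with
    | base => rfl
    | succ n hn ih =>
      have := hN n hn
      rw [Set.mem_symmDiff] at this
      tauto
  by_cases h : x ∈ L N
  · exact Or.inl (eventually_atTop.mpr ⟨N, fun n hn => (hstep n hn).mp h⟩)
  · exact Or.inr (eventually_atTop.mpr ⟨N, fun n hn hx => h ((hstep n hn).mpr hx)⟩)

theorem measurableSet_eventually_mem {L : ℕ → Set Ω} (hL : ∀ n, MeasurableSet (L n)) :
    MeasurableSet {x | ∀ᶠ n in atTop, x ∈ L n} := by
  have : {x | ∀ᶠ n in atTop, x ∈ L n} = ⋃ N, ⋂ n, ⋂ _ : N ≤ n, L n := by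
    ext x; simp [eventually_atTop]
  rw [this]
  exact MeasurableSet.iUnion fun N => MeasurableSet.iInter fun n => MeasurableSet.iInter fun _ =>
    hL n

theorem measureReal_eventually_mem {L : ℕ → Set Ω} {p : ℝ} (hL : ∀ n, MeasurableSet (L n))
    (hp : ∀ n, |ν.real (L n) - p| ≤ (1 / 2) ^ n)
    (h : ∀ᵐ x ∂ν, (∀ᶠ n in atTop, x ∈ L n) ∨ ∀ᶠ n in atTop, x ∉ L n) :
    ν.real {x | ∀ᶠ n in atTop, x ∈ L n} = p := by
  have h1 := tendsto_measure_of_ae_tendsto_indicator_of_isFiniteMeasure (μ := ν) atTop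
    (measurableSet_eventually_mem hL) hL (by
      filter_upwards [h] with x hx
      rcases hx with hx | hx
      · filter_upwards [hx] with n hn
        exact ⟨fun _ => hx, fun _ => hn⟩
      · filter_upwards [hx] with n hn
        refine ⟨fun h => absurd h hn, fun h' => ?_⟩
        obtain ⟨k, hk, hk'⟩ := (hx.and h').exists
        exact absurd hk' hk)
  have h2 : Tendsto (fun n => ν.real (L n)) atTop (𝓝 (ν.real {x | ∀ᶠ n in atTop, x ∈ L n})) :=
    (ENNReal.tendsto_toReal (measure_ne_top _ _)).comp h1
  have h3 : Tendsto (fun n => ν.real (L n)) atTop (𝓝 p) := by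
    rw [tendsto_iff_dist_tendsto_zero]
    exact squeeze_zero (fun _ => dist_nonneg) hp
      (tendsto_pow_atTop_nhds_zero_of_lt_one (by norm_num) (by norm_num))
  exact tendsto_nhds_unique h2 h3

/-- Markov's inequality at threshold `2⁻ⁿ` turns `4⁻ⁿ` into measure `2⁻ⁿ`; then Borel–Cantelli. -/
theorem ae_tendsto_of_integral_abs_sub_le {g : ℕ → Ω → ℝ} {s : ℝ}
    (hg : ∀ n, Integrable (fun x => |g n x - s|) ν)
    (h : ∀ n, ∫ x, |g n x - s| ∂ν ≤ (1 / 4) ^ n) :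
    ∀ᵐ x ∂ν, Tendsto (fun n => g n x) atTop (𝓝 s) := by
  have hle : ∀ n, ν {x | (1 / 2) ^ n ≤ |g n x - s|} ≤ ENNReal.ofReal ((1 / 2) ^ n) := fun n => by
    rw [← ofReal_measureReal]
    refine ENNReal.ofReal_le_ofReal ?_
    have h1 := (mul_meas_ge_le_integral_of_nonneg (ae_of_all _ fun x => abs_nonneg (g n x - s))
      (hg n) ((1 / 2) ^ n)).trans (h n)
    have hpos : (0 : ℝ) < (1 / 2) ^ n := by positivity
    rw [show (1 / 4 : ℝ) ^ n = (1 / 2) ^ n * (1 / 2) ^ n by rw [← mul_pow]; norm_num] at h1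
    exact le_of_mul_le_mul_left h1 hpos
  have hne : ∑' n, ν {x | (1 / 2) ^ n ≤ |g n x - s|} ≠ ∞ :=
    ne_top_of_le_ne_top
      (summable_geometric_of_lt_one (r := 1 / 2) (by norm_num) (by norm_num)).tsum_ofReal_ne_top
      (ENNReal.tsum_le_tsum hle)
  filter_upwards [ae_eventually_notMem hne] with x hx
  rw [tendsto_iff_dist_tendsto_zero]
  refine squeeze_zero' (Eventually.of_forall fun _ => dist_nonneg) ?_
    (tendsto_pow_atTop_nhds_zero_of_lt_one (r := (1 / 2 : ℝ)) (by norm_num) (by norm_num))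
  filter_upwards [hx] with n hn
  exact (not_le.mp hn).le

end Chains

/-! ### Rigidity of the middle cell -/

section Middle

/-- In the middle cell, approximate solutions of `v ^ 3 - v = s` are close to the root. -/
theorem tendsto_middle_root {w r : ℝ} (hw : 3 * w ^ 2 = 1) (hr : r ∈ Set.Ioo (-w) w)
    {v : ℕ → ℝ} (hv : ∀ᶠ n in atTop, v n ∈ Set.Ioo (-w) w)
    (h : Tendsto (fun n => (v n) ^ 3 - v n) atTop (𝓝 (r ^ 3 - r))) : Tendsto v atTop (𝓝 r) := by
  obtain ⟨hr1, hr2⟩ := hr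
  -- The negated cofactor is concave in `v`, so on the cell it is at least the smaller of its values
  -- at `w` and `-w`.
  have hδ : 0 < min ((r + 2 * w) * (w - r)) ((2 * w - r) * (r + w)) :=
    lt_min (mul_pos (by linarith) (by linarith)) (mul_pos (by linarith) (by linarith))
  set δ := min ((r + 2 * w) * (w - r)) ((2 * w - r) * (r + w))
  rw [tendsto_iff_dist_tendsto_zero] at h ⊢
  have h' := h.const_mul δ⁻¹
  rw [mul_zero] at h'
  refine squeeze_zero' (Eventually.of_forall fun _ => dist_nonneg) ?_ h'
  filter_upwards [hv] with n ⟨h1, h2⟩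
  rw [Real.dist_eq, Real.dist_eq, inv_mul_eq_div, le_div_iff₀ hδ,
    show (v n) ^ 3 - v n - (r ^ 3 - r) = (v n - r) * ((v n) ^ 2 + v n * r + r ^ 2 - 1) by ring,
    abs_mul]
  refine mul_le_mul_of_nonneg_left (le_trans ?_ (neg_le_abs _)) (abs_nonneg _)
  rcases le_or_gt 0 (v n + w + r) with h3 | h3
  · refine (min_le_left _ _).trans ?_
    linarith [mul_nonneg (show 0 ≤ w - v n by linarith) h3,
      show -((v n) ^ 2 + v n * r + r ^ 2 - 1) - (r + 2 * w) * (w - r) =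
        (w - v n) * (v n + w + r) by linear_combination -hw]
  · refine (min_le_right _ _).trans ?_
    linarith [mul_nonneg (show 0 ≤ v n + w by linarith) (show 0 ≤ w - v n - r by linarith),
      show -((v n) ^ 2 + v n * r + r ^ 2 - 1) - (2 * w - r) * (r + w) =
        (v n + w) * (w - v n - r) by linear_combination -hw]

namespace IsBoundedSolution

variable {Ω : Type*} [MeasurableSpace Ω] {ν : Measure Ω} {u : Ω → ℝ → ℝ}

/-- Two trajectories between an upper and a lower one cannot approach each other along a sequence
of times at which they stay away from the other two. -/
theorem not_lt_of_tendsto (hu : IsBoundedSolution ν (fun v : ℝ => v ^ 3 - v) u) {x v v' z : Ω}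
    {w r : ℝ} {τ : ℕ → ℝ} (hτ : ∀ n, 0 ≤ τ n) (hr : r ∈ Set.Ioo (-w) w)
    (hx : ∀ᶠ n in atTop, u x (τ n) ≤ -w) (hz : ∀ᶠ n in atTop, w ≤ u z (τ n))
    (hv : Tendsto (fun n => u v (τ n)) atTop (𝓝 r))
    (hv' : Tendsto (fun n => u v' (τ n)) atTop (𝓝 r)) : ¬ u v 0 < u v' 0 := by
  intro hlt
  obtain ⟨M, -, hM⟩ := hu.exists_bound
  have ev := hv.eventually (Ioo_mem_nhds hr.1 hr.2)
  have ev' := hv'.eventually (Ioo_mem_nhds hr.1 hr.2)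
  obtain ⟨n, hxn, hzn, hvn, hvn'⟩ := (hx.and (hz.and (ev.and ev'))).exists
  have l1 : u x 0 < u v 0 := (hu.lt_iff x v (hτ n)).mp (hxn.trans_lt hvn.1)
  have l3 : u v' 0 < u z 0 := (hu.lt_iff v' z (hτ n)).mp (hvn'.2.trans_le hzn)
  -- This majorant of the cross ratio tends to zero, as the inner gap closes while both outer gaps
  -- stay open.
  have hlim : Tendsto (fun n => (u v' (τ n) - u v (τ n)) * (2 * M) /
      ((u v (τ n) + w) * (w - u v' (τ n)))) atTop
      (𝓝 ((r - r) * (2 * M) / ((r + w) * (w - r)))) :=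
    ((hv'.sub hv).mul_const _).div ((hv.add_const w).mul (hv'.const_sub w))
      (mul_pos (by linarith [hr.1]) (by linarith [hr.2])).ne'
  rw [sub_self, zero_mul, zero_div] at hlim
  have hle := ge_of_tendsto hlim (b := (u v' 0 - u v 0) * (u z 0 - u x 0) /
      ((u v 0 - u x 0) * (u z 0 - u v' 0))) (by
    filter_upwards [hx, hz, ev, ev'] with n hxn hzn hvn hvn'
    refine (hu.crossRatio_le l1 hlt l3 (hτ n)).trans ?_
    have d : 0 < u v' (τ n) - u v (τ n) := sub_pos.mpr ((hu.lt_iff v v' (hτ n)).mpr hlt)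
    have b1 := (abs_le.mp (hM x (τ n) (hτ n))).1
    have b2 := (abs_le.mp (hM z (τ n) (hτ n))).2
    have c1 : 0 < u v (τ n) + w := by linarith [hvn.1]
    have c2 : 0 < w - u v' (τ n) := by linarith [hvn'.2]
    have c3 : 0 < u z (τ n) - u x (τ n) := by linarith [hvn.1, hvn.2]
    apply div_le_div₀
    · exact mul_nonneg d.le (by linarith)
    · exact mul_le_mul_of_nonneg_left (by linarith) d.le
    · exact mul_pos c1 c2
    · exact mul_le_mul (by linarith) (by linarith) c2.le (by linarith))
  refine hle.not_gt ?_
  have p1 := sub_pos.mpr l1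
  have p2 := sub_pos.mpr hlt
  have p3 := sub_pos.mpr l3
  have p4 := sub_pos.mpr (l1.trans (hlt.trans l3))
  positivity

end IsBoundedSolution

end Middle

/-! ### From late times back to time zero -/

theorem mainTheorem4 {Ω : Type*} [MeasurableSpace Ω] (ν : Measure Ω) [IsProbabilityMeasure ν]
    (u : Ω → ℝ → ℝ) (hu : IsBoundedSolution ν (fun v : ℝ => v ^ 3 - v) u)
    (hnc : ¬ ConvergesInL2 ν u) :
    ∫ x, u x 0 ∂ν = 0 ∧
      ∃ c : ℝ, ν {x | u x 0 = c} = 1 / 3 ∧ ν {x | c < u x 0} = 1 / 3 ∧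
        ν {x | u x 0 < c} = 1 / 3 := by
  obtain ⟨w, hw0, hw⟩ : ∃ w : ℝ, 0 < w ∧ 3 * w ^ 2 = 1 :=
    ⟨√(1 / 3), by positivity, by rw [Real.sq_sqrt] <;> norm_num⟩
  obtain ⟨hm, s, hs1, hs2, hfreq, hbot, htop⟩ := hu.integral_eq_zero_and_exists_level hw0 hw hnc
  refine ⟨hm, ?_⟩
  obtain ⟨-, ⟨r, hr, rfl⟩, -⟩ := exists_three_roots hw0 hw hs1 hs2
  have htimes : ∀ n : ℕ, ∃ t, 0 ≤ t ∧ meanForce ν u t = r ^ 3 - r ∧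
      ∫ x, |(u x t) ^ 3 - u x t - meanForce ν u t| ∂ν ≤ (1 / 4) ^ n ∧
      |ν.real {x | u x t ∈ Set.Iic (-w)} - 1 / 3| ≤ (1 / 2) ^ n ∧
      |ν.real {x | u x t ∈ Set.Ici w} - 1 / 3| ≤ (1 / 2) ^ n := fun n => by
    have h2 : (0 : ℝ) < (1 / 2) ^ n := by positivity
    have e1 := hu.tendsto_integral_abs_sub.eventually_le_const
      (show (0 : ℝ) < (1 / 4) ^ n by positivity)
    have e2 := eventually_inf_principal.mp (hbot.eventually (Metric.closedBall_mem_nhds _ h2))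
    have e3 := eventually_inf_principal.mp (htop.eventually (Metric.closedBall_mem_nhds _ h2))
    obtain ⟨t, ht, ht0, h1, h2, h3⟩ :=
      (hfreq.and_eventually ((eventually_ge_atTop 0).and (e1.and (e2.and e3)))).exists
    exact ⟨t, ht0, ht, h1, h2 ht, h3 ht⟩
  choose τ hτ hσ hD hN₁ hN₃ using htimes
  have hcomp : ∀ {x y : Ω} {n k : ℕ}, u x (τ n) < u y (τ n) → u x (τ k) < u y (τ k) :=
    fun {x y n k} h => (hu.lt_iff x y (hτ k)).mpr ((hu.lt_iff x y (hτ n)).mp h)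
  have hL₁ : ∀ n, MeasurableSet {x | u x (τ n) ∈ Set.Iic (-w)} := fun n =>
    hu.measurable _ (hτ n) measurableSet_Iic
  have hL₃ : ∀ n, MeasurableSet {x | u x (τ n) ∈ Set.Ici w} := fun n =>
    hu.measurable _ (hτ n) measurableSet_Ici
  -- Order preservation makes the sublevel sets at different times nested.
  have hG₁ := ae_eventually_mem_or_notMem hL₁ (fun n k => by
    by_contra! H
    obtain ⟨⟨x, hx, hx'⟩, ⟨y, hy, hy'⟩⟩ :=
      And.intro (Set.not_subset.mp H.1) (Set.not_subset.mp H.2)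
    have h1 := hcomp (k := k) (lt_of_le_of_lt hx (not_le.mp hy'))
    exact absurd h1 (lt_of_le_of_lt hy (not_le.mp hx')).not_gt) hN₁
  have hG₃ := ae_eventually_mem_or_notMem hL₃ (fun n k => by
    by_contra! H
    obtain ⟨⟨x, hx, hx'⟩, ⟨y, hy, hy'⟩⟩ :=
      And.intro (Set.not_subset.mp H.1) (Set.not_subset.mp H.2)
    have h1 := hcomp (k := k) (lt_of_lt_of_le (not_le.mp hy') hx)
    exact absurd h1 (lt_of_lt_of_le (not_le.mp hx') hy).not_gt) hN₃
  have hG₂ := ae_tendsto_of_integral_abs_sub_le (ν := ν) (s := r ^ 3 - r)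
    (g := fun n x => (u x (τ n)) ^ 3 - u x (τ n))
    (fun n => hu.integrable_comp (φ := fun v => |v ^ 3 - v - (r ^ 3 - r)|) (by fun_prop) (hτ n))
    (fun n => by simpa only [hσ] using hD n)
  have hA₁ := measureReal_eventually_mem hL₁ hN₁ hG₁
  have hA₃ := measureReal_eventually_mem hL₃ hN₃ hG₃
  have hmA₁ := measurableSet_eventually_mem hL₁
  have hmA₃ := measurableSet_eventually_mem hL₃
  set A₁ := {x | ∀ᶠ n in atTop, x ∈ {x | u x (τ n) ∈ Set.Iic (-w)}}
  set A₃ := {x | ∀ᶠ n in atTop, x ∈ {x | u x (τ n) ∈ Set.Ici w}}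
  have hdisj : Disjoint A₁ A₃ := Set.disjoint_left.mpr fun x h1 h3 => by
    obtain ⟨n, h1, h3⟩ := (h1.and h3).exists
    have h1 : u x (τ n) ≤ -w := h1
    have h3 : w ≤ u x (τ n) := h3
    linarith
  have hA₂ : ν.real (A₁ ∪ A₃)ᶜ = 1 / 3 := by
    rw [probReal_compl_eq_one_sub (hmA₁.union hmA₃), measureReal_union hdisj hmA₃, hA₁, hA₃]
    norm_num
  have hthird : ∀ {A : Set Ω}, ν.real A = 1 / 3 → ν A = 1 / 3 := fun {A} h => by
    rw [← ofReal_measureReal, h, ENNReal.ofReal_div_of_pos (by norm_num)]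
    simp
  have hex : ∀ {A : Set Ω} {P : Ω → Prop}, ν.real A = 1 / 3 → (∀ᵐ x ∂ν, P x) →
      ∃ x ∈ A, P x := fun {A P} h hP =>
    ((frequently_ae_mem_iff.mpr (by rw [hthird h]; simp)).and_eventually hP).exists
  -- Only the outer trajectories for the cross ratio are wanted; `hG₁` merely fills the
  -- almost-everywhere slot.
  obtain ⟨a, ha, -⟩ := hex hA₁ hG₁
  obtain ⟨b, hb, -⟩ := hex hA₃ hG₁
  have hmid : ∀ x, (x ∉ A₁ ∧ x ∉ A₃) → ((∀ᶠ n in atTop, x ∈ {x | u x (τ n) ∈ Set.Iic (-w)}) ∨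
      ∀ᶠ n in atTop, x ∉ {x | u x (τ n) ∈ Set.Iic (-w)}) →
      ((∀ᶠ n in atTop, x ∈ {x | u x (τ n) ∈ Set.Ici w}) ∨
      ∀ᶠ n in atTop, x ∉ {x | u x (τ n) ∈ Set.Ici w}) →
      ∀ᶠ n in atTop, u x (τ n) ∈ Set.Ioo (-w) w := fun x hx h1 h3 => by
    filter_upwards [h1.resolve_left hx.1, h3.resolve_left hx.2] with n g1 g3
    exact ⟨not_le.mp g1, not_le.mp g3⟩
  -- A typical middle point, whose initial value serves as `c`.
  obtain ⟨y, hy, ⟨hy1, hy3⟩, hy2⟩ := hex hA₂ ((hG₁.and hG₃).and hG₂)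
  rw [Set.mem_compl_iff, Set.mem_union, not_or] at hy
  have hyI := hmid y hy hy1 hy3
  have hyr := tendsto_middle_root hw hr hyI hy2
  have key : ∀ᵐ x ∂ν, (x ∈ A₁ → u x 0 < u y 0) ∧ (x ∈ A₃ → u y 0 < u x 0) ∧
      (x ∈ (A₁ ∪ A₃)ᶜ → u x 0 = u y 0) := by
    filter_upwards [hG₁, hG₂, hG₃] with x hx1 hx2 hx3
    refine ⟨fun hx => ?_, fun hx => ?_, fun hx => ?_⟩
    · obtain ⟨n, h1, h2⟩ := (hyI.and hx).exists
      exact (hu.lt_iff x y (hτ n)).mp (lt_of_le_of_lt h2 h1.1)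
    · obtain ⟨n, h1, h2⟩ := (hyI.and hx).exists
      exact (hu.lt_iff y x (hτ n)).mp (lt_of_lt_of_le h1.2 h2)
    · rw [Set.mem_compl_iff, Set.mem_union, not_or] at hx
      have hxr := tendsto_middle_root hw hr (hmid x hx hx1 hx3) hx2
      exact le_antisymm (not_lt.mp (hu.not_lt_of_tendsto hτ hr ha hb hyr hxr))
        (not_lt.mp (hu.not_lt_of_tendsto hτ hr ha hb hxr hyr))
  refine ⟨u y 0, ?_, ?_, ?_⟩
  · rw [← hthird hA₂]
    refine measure_congr (eventuallyEq_set.mpr ?_)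
    filter_upwards [key] with x ⟨k1, k3, k2⟩
    refine ⟨fun (h : u x 0 = u y 0) => ?_, k2⟩
    rintro (h1 | h3)
    · exact (k1 h1).ne h
    · exact (k3 h3).ne' h
  · rw [← hthird hA₃]
    refine measure_congr (eventuallyEq_set.mpr ?_)
    filter_upwards [key] with x ⟨k1, k3, k2⟩
    refine ⟨fun (h : u y 0 < u x 0) => ?_, k3⟩
    by_contra h3
    by_cases h1 : x ∈ A₁
    · exact (k1 h1).not_gt h
    · exact h.ne' (k2 fun h' => h'.elim h1 h3)
  · rw [← hthird hA₁]
    refine measure_congr (eventuallyEq_set.mpr ?_)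
    filter_upwards [key] with x ⟨k1, k3, k2⟩
    refine ⟨fun (h : u x 0 < u y 0) => ?_, k1⟩
    by_contra h1
    by_cases h3 : x ∈ A₃
    · exact (k3 h3).not_gt h
    · exact h.ne (k2 fun h' => h'.elim h1 h3)
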